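/- Theorem 1.12 (Asymptotics for induced complete multilevel posets). Definitions. For positive integers $r_1,\dots,r_k$ let $K_{r_1,\dots,r_k}$ be the poset on elements $a^i_h$ ($1\le i\le k$, $1\le h\le r_i$) with $a^i_h<a^j_l$ if and only if $i<j$. A family $\mathcal F\subseteq 2^{[n]}$, ordered by inclusion, is *induced $P$-free* if there is no injection $\iota:P\to\mathcal F$ with $p\le q\iff \iota(p)\subseteq\iota(q)$ for all $p,q\in P$; $La^*(n,P)$ is the maximum size of an induced $P$-free family $\mathcal F\subseteq2^{[n]}$, and $\pi^*(P)=\lim_{n\to\infty}La^*(n,P)/\binom{n}{\lfloor n/2\rfloor}$ whenever this limit exists. Let $e^*(P)$ be the largest integer $k$ such that for all $n$ every union of $k$ consecutive levels of $2^{[n]}$ is induced $P$-free. Write $\Sigma(n,k)=\sum_{i=1}^k\binom{n}{\lfloor (n-k)/2\rfloor+i}$, $m^*_s=\min\{m: s\le\binom{m}{\lceil m/2\rceil}\}$, and, for positive integers $r,t$, $f(r,t)=0$ if $r=t=1$, $f(r,t)=1$ if exactly one of $r,t$ equals $1$, and $f(r,t)=2$ if $r,t\ge2$. All asymptotic notation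 refers to $n\to\infty$ with the poset fixed; implied constants and $o(\cdot)$ terms may depend on all of its level sizes. (i) For all positive integers $r,t$, $$\Sigma(n,4+f(r,t))+\Big(\tfrac{r+t-2}{n}-O_{r,t}\big(\tfrac1{n^2}\big)\Big)\tbinom{n}{\lceil n/2\rceil}\le La^*(n,K_{r,4,t})\le\Big(4+f(r,t)+\tfrac{2(r+t-2)}{n}+o\big(\tfrac1n\big)\Big)\tbinom{n}{\lfloor n/2\rfloor}.$$ In particular $\pi^*(K_{r,4,t})$ exists and equals $4+f(r,t)$. (ii) For every real $c$ with $1/2<c<1$ there is an integer $s_c$ such that for all positive integers $r,t$ and all $s\ge s_c$ with $s\le c\binom{m^*_s}{\lceil m^*_s/2\rceil}$, $$\Sigma(n,m^*_s+f(r,t))+\Big(\tfrac{r+t-2}{n}-O_{r,s,t}\big(\tfrac1{n^2}\big)\Big)\tbinom{n}{\lceil n/2\rceil}\le La^*(n,K_{r,s,t})\le\Big(m^*_s+f(r,t)+\tfrac{2(r+t-2)}{n}+o\big(\tfrac1n\big)\Big)\tbinom{n}{\lfloor n/2\rfloor}.$$ In particular $\pi^*(K_{r,s,t})$ exists and equals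 $m^*_s+f(r,t)$. (iii) There is an integer $s_0$ such that for all positive integers $r,t$ and all $s\ge s_0$, $$\Sigma(n,m^*_s+f(r,t))+\Big(\tfrac{r+t-2}{n}-O_{r,s,t}\big(\tfrac1{n^2}\big)\Big)\tbinom{n}{\lceil n/2\rceil}\le La^*(n,K_{r,s,t})\le\Big(m^*_s+1+f(r,t)+\tfrac{2(r+t-2)}{n}+o\big(\tfrac1n\big)\Big)\tbinom{n}{\lfloor n/2\rfloor}.$$ (iv) For every real $c$ with $1/2<c<1$ there is an integer $s_c$ such that for all positive integers $r,t$, all $j\ge1$ and all positive integers $s_1,\dots,s_j$, if each $s_i$ satisfies either $s_i=4$, or $s_i\ge s_c$ and $s_i\le c\binom{m^*_{s_i}}{\lceil m^*_{s_i}/2\rceil}$, then $$La^*(n,K_{r,s_1,\dots,s_j,t})=\Big(e^*(K_{r,s_1,\dots,s_j,t})+O_{r,s_1,\dots,s_j,t}\big(\tfrac1n\big)\Big)\tbinom{n}{\lfloor n/2\rfloor}.$$ -/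

import Mathlib

open Filter Topology

/-- The complete multilevel poset `K_{ℓ₁,…,ℓ_k}` of a list `ℓ` of level sizes: an element is a pair
`(i, h)` of a level `i` and a position `h` among the `ℓ_i` elements of that level. -/
structure CompleteMultilevel (ℓ : List ℕ) where
  level : Fin ℓ.length
  pos : Fin (ℓ.get level)

/-- An element is strictly below another one exactly when its level is strictly lower. -/
instance (ℓ : List ℕ) : PartialOrder (CompleteMultilevel ℓ) where
  le x y := x = y ∨ x.level < y.level
  lt x y := x.level < y.level
  le_refl x := Or.inl rfl
  le_trans := by
    rintro x y z (rfl | h) (rfl | h')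
    · exact Or.inl rfl
    · exact Or.inr h'
    · exact Or.inr h
    · exact Or.inr (h.trans h')
  le_antisymm := by
    rintro x y (rfl | h) (h' | h')
    · rfl
    · rfl
    · exact h'.symm
    · exact absurd h (not_lt.mpr h'.le)
  lt_iff_le_not_ge := by
    intro x y
    constructor
    · intro h
      refine ⟨Or.inr h, ?_⟩
      rintro (rfl | h')
      · exact lt_irrefl _ h
      · exact absurd h (not_lt.mpr h'.le)
    · rintro ⟨rfl | h, h'⟩
      · exact absurd (Or.inl rfl) h'
      · exact h

/-- The poset `K_{r,s₁,…,s_j,t}`; the list `ss` holds the sizes of the middle levels. -/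
abbrev KPoset (r : ℕ) (ss : List ℕ) (t : ℕ) : Type :=
  CompleteMultilevel (r :: (ss ++ [t]))

/-- A family of subsets of an `n`-element set, ordered by inclusion, is induced `P`-free if it
contains no induced copy of `P`: an order embedding satisfies `i p ≤ i q ↔ p ≤ q`. -/
def InducedFree (P : Type) [PartialOrder P] {n : ℕ} (F : Set (Finset (Fin n))) : Prop :=
  ¬ ∃ i : P ↪o Finset (Fin n), ∀ p, i p ∈ F

/-- `La*(n, P)`: the maximum size of an induced `P`-free family of subsets of `[n]`. -/
noncomputable def LaStar (P : Type) [PartialOrder P] (n : ℕ) : ℕ :=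
  sSup {k | ∃ F : Finset (Finset (Fin n)), InducedFree P (F : Set (Finset (Fin n))) ∧ F.card = k}

/-- The `k` consecutive levels `a, a + 1, …, a + k - 1` of the Boolean lattice on `[n]`. -/
def consecutiveLevels (n a k : ℕ) : Set (Finset (Fin n)) :=
  {A | a ≤ A.card ∧ A.card < a + k}

/-- `e*(P)`: the largest `k` such that any `k` consecutive levels of any Boolean lattice form
an induced `P`-free family. -/
noncomputable def eStar (P : Type) [PartialOrder P] : ℕ :=
  sSup {k | ∀ n a : ℕ, InducedFree P (consecutiveLevels n a k)}

/-- `π*(P)` exists and is equal to `x`. -/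
def HasPiStar (P : Type) [PartialOrder P] (x : ℝ) : Prop :=
  Tendsto (fun n : ℕ => (LaStar P n : ℝ) / (n.choose (n / 2) : ℝ)) atTop (𝓝 x)

/-- `Σ(n, k)`, the total size of `k` middle levels of the Boolean lattice on `[n]`
(for `k ≤ n`). -/
def middleSum (n k : ℕ) : ℕ :=
  ∑ i ∈ Finset.Icc 1 k, n.choose ((n - k) / 2 + i)

/-- The function `f(r, t)` for positive `r`, `t`. -/
def fPair (r t : ℕ) : ℕ :=
  if r = 1 ∧ t = 1 then 0 else if r = 1 ∨ t = 1 then 1 else 2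

/-- `m*_s`: the least `m` such that `s` is at most the binomial coefficient `m` over `⌈m / 2⌉`
(and `⌈m / 2⌉` is `(m + 1) / 2` with division of natural numbers). -/
noncomputable def mStar (s : ℕ) : ℕ :=
  sInf {m | s ≤ m.choose ((m + 1) / 2)}

/-- The supremum in the definition of `LaStar` is a maximum. -/
theorem laStar_isGreatest (P : Type) [PartialOrder P] [Nonempty P] (n : ℕ) :
    IsGreatest {k | ∃ F : Finset (Finset (Fin n)),
      InducedFree P (F : Set (Finset (Fin n))) ∧ F.card = k} (LaStar P n) := by
  have hb : BddAbove {k | ∃ F : Finset (Finset (Fin n)),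
      InducedFree P (F : Set (Finset (Fin n))) ∧ F.card = k} := by
    refine ⟨Fintype.card (Finset (Fin n)), ?_⟩
    rintro k ⟨F, -, rfl⟩
    exact Finset.card_le_univ F
  refine ⟨Nat.sSup_mem ⟨0, ∅, ?_, rfl⟩ hb, fun k hk => le_csSup hb hk⟩
  rintro ⟨i, hi⟩
  simpa using hi (Classical.arbitrary P)

/-- The supremum in the definition of `eStar` is a maximum. -/
theorem eStar_isGreatest (P : Type) [PartialOrder P] [Finite P] [Nonempty P] :
    IsGreatest {k | ∀ n a : ℕ, InducedFree P (consecutiveLevels n a k)} (eStar P) := by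
  classical
  cases nonempty_fintype P
  have hb : BddAbove {k | ∀ n a : ℕ, InducedFree P (consecutiveLevels n a k)} := by
    refine ⟨Fintype.card P, fun k hk => ?_⟩
    by_contra hlt
    let e := Fintype.equivFin P
    have hmap : ∀ p q : P, (Finset.univ.filter fun x => e.symm x ≤ p) ≤
        (Finset.univ.filter fun x => e.symm x ≤ q) ↔ p ≤ q := by
      intro p q
      constructor
      · intro h
        have hp : e p ∈ Finset.univ.filter fun x => e.symm x ≤ p := by simp
        simpa using h hp
      · intro h x hx
        simp only [Finset.mem_filter, Finset.mem_univ, true_and] at hx ⊢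
        exact hx.trans h
    refine hk (Fintype.card P) 0 ⟨OrderEmbedding.ofMapLEIff _ hmap, fun p => ?_⟩
    have hc := Finset.card_le_univ (OrderEmbedding.ofMapLEIff _ hmap p)
    simp only [Fintype.card_fin] at hc
    exact ⟨Nat.zero_le _, by omega⟩
  refine ⟨Nat.sSup_mem ⟨0, fun n a => ?_⟩ hb, fun k hk => le_csSup hb hk⟩
  rintro ⟨i, hi⟩
  have h := hi (Classical.arbitrary P)
  exact absurd h.2 (not_lt.mpr (by simpa using h.1))

/-- The infimum in the definition of `mStar` is a minimum. -/
theorem mStar_isLeast (s : ℕ) : IsLeast {m | s ≤ m.choose ((m + 1) / 2)} (mStar s) := by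
  refine ⟨Nat.sInf_mem ⟨s, ?_⟩, fun m hm => Nat.sInf_le hm⟩
  rcases Nat.eq_zero_or_pos s with rfl | hs
  · exact Nat.zero_le _
  · have h1 : s.choose 1 ≤ s.choose (s / 2) := Nat.choose_le_middle 1 s
    have h2 : s.choose ((s + 1) / 2) = s.choose (s / 2) :=
      Nat.choose_symm_of_eq_add (by omega)
    simpa [h2] using h1

/-! Upper bound. The size of a family is at most its Lubell mass (the expected number of members on
a random maximal chain) times the central binomial coefficient. Walk up a random chain and cut it at
the first set with an `r`-antichain of members below it, then at the first set with an
`s₁`-antichain between the previous cut and itself, and so on. In a free family the cuts cannot all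
succeed, so the mass is bounded by a sum over the pieces (`lubell_le_add_of_not_hasStack`). An
interval of dimension `N` without `s` incomparable members has at most `s - 1` of them on each
level, hence mass at most `capSum (s - 1) N`. This is nonincreasing in `N` from `mStar s` on
(`capSum_anti`, for the sizes at hand), and at `N = mStar s` it is at most `mStar s`: for `s = 4` by
computation, and for large `s` below the fraction `c` because many middle levels contribute less
than one by a fixed amount (`exists_capSum_middle_le`). Without the fraction only `mStar s + 1` is
obtained.

Levels far from the middle are discarded at exponentially small cost. An end interval then has
dimension at least nearly `n / 2`. It contributes one for its extreme level if `r ≥ 2`, and about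
`(r - 1) * (2 / n)` for the next one; likewise for `t`. This is the source of `fPair r t` and of `2
* (r + t - 2) / n`.

Lower bound. By Sperner's theorem an `s`-antichain in `[A, X]` needs `#X - #A ≥ mStar s`
(`HasAntichain.add_mStar_le`), and an end level with at least two elements costs one more level, so
the sum of the `mStar s` plus `fPair r t` consecutive levels are free. They stay free after adding
just below and just above them families of which every neighbouring set sees at most `r - 1`,
respectively `t - 1`, members; residue classes of element sums modulo `n` supply such families
(`exists_sparse_family`). -/

/-! ### Lubell mass of a family in an interval. -/

section Lubell
open Finset

variable {α : Type*}

/-- There are `s` pairwise incomparable members of `F` in the interval `[A, B]`. -/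
def HasAntichain (F : Set (Finset α)) (A B : Finset α) (s : ℕ) : Prop :=
  ∃ S : Finset (Finset α), #S = s ∧ IsAntichain (· ⊆ ·) (S : Set (Finset α)) ∧
    ∀ X ∈ S, X ∈ F ∧ A ⊆ X ∧ X ⊆ B

theorem HasAntichain.mono {F : Set (Finset α)} {A B B' : Finset α} {s : ℕ}
    (h : HasAntichain F A B s) (hB : B ⊆ B') : HasAntichain F A B' s := by
  obtain ⟨S, h1, h2, h3⟩ := h
  exact ⟨S, h1, h2, fun X hX => ⟨(h3 X hX).1, (h3 X hX).2.1, (h3 X hX).2.2.trans hB⟩⟩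

/-- An average is at most the maximum. This turns the identities for conditioning on one step of a
chain into induction steps. -/
theorem le_of_card_mul_eq_sum {s : Finset α} (hs : s.Nonempty) {x K : ℝ} {g : α → ℝ}
    (h : (#s : ℝ) * x = ∑ b ∈ s, g b) (hg : ∀ b ∈ s, g b ≤ K) : x ≤ K := by
  have h1 := sum_le_card_nsmul s g K hg
  rw [nsmul_eq_mul, ← h] at h1
  exact le_of_mul_le_mul_left h1 (by exact_mod_cast hs.card_pos)

variable [DecidableEq α]

/-- The Lubell mass of the part of `F` in the interval `[A, B]`: the expected number of members of
`F` on a random maximal chain from `A` to `B`. -/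
noncomputable def lubell (F : Finset (Finset α)) (A B : Finset α) : ℝ :=
  ∑ X ∈ F with A ⊆ X ∧ X ⊆ B, ((#B - #A).choose (#X - #A) : ℝ)⁻¹

theorem lubell_mono {F G : Finset (Finset α)} (h : F ⊆ G) (A B : Finset α) :
    lubell F A B ≤ lubell G A B :=
  sum_le_sum_of_subset_of_nonneg (filter_subset_filter _ h) fun _ _ _ => by positivity

theorem lubell_filter_add_filter_not (F : Finset (Finset α)) (p : Finset α → Prop)
    [DecidablePred p] (A B : Finset α) :
    lubell {X ∈ F | p X} A B + lubell {X ∈ F | ¬ p X} A B = lubell F A B := by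
  unfold lubell
  rw [← sum_filter_add_sum_filter_not (s := {X ∈ F | A ⊆ X ∧ X ⊆ B}) (p := p)]
  simp only [filter_filter, and_comm]

theorem choose_inv_mul_sub {N k : ℕ} (h : k < N) :
    (N : ℝ) * (N.choose k : ℝ)⁻¹ = (N - k : ℕ) * ((N - 1).choose k : ℝ)⁻¹ := by
  obtain ⟨N, rfl⟩ : ∃ M, N = M + 1 := ⟨N - 1, by omega⟩
  have h1 : 0 < (N + 1).choose k := Nat.choose_pos h.le
  have h2 : 0 < N.choose k := Nat.choose_pos (by omega)
  have h3 := Nat.choose_mul_succ_eq N k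
  have h4 : (N.choose k : ℝ) * ((N + 1 : ℕ) : ℝ) = ((N + 1).choose k : ℝ) * ((N + 1 - k : ℕ) : ℝ) := by
    exact_mod_cast h3
  simp only [Nat.add_sub_cancel]
  field_simp
  linarith

theorem choose_inv_mul_self {N k : ℕ} (h : k < N) :
    (N : ℝ) * (N.choose (k + 1) : ℝ)⁻¹ = (k + 1 : ℕ) * ((N - 1).choose k : ℝ)⁻¹ := by
  obtain ⟨N, rfl⟩ : ∃ M, N = M + 1 := ⟨N - 1, by omega⟩
  have h1 : 0 < (N + 1).choose (k + 1) := Nat.choose_pos (by omega)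
  have h2 : 0 < N.choose k := Nat.choose_pos (by omega)
  have h3 := Nat.add_one_mul_choose_eq N k
  have h4 : ((N + 1 : ℕ) : ℝ) * (N.choose k : ℝ) = ((N + 1).choose (k + 1) : ℝ) * ((k + 1 : ℕ) : ℝ) := by
    exact_mod_cast h3
  simp only [Nat.add_sub_cancel]
  field_simp
  linarith

/-- Conditioning a random chain on its last step. -/
theorem lubell_eq_sum_erase {F : Finset (Finset α)} {A B : Finset α} (hB : B ∉ F) :
    (#B - #A : ℕ) * lubell F A B = ∑ b ∈ B \ A, lubell F A (B.erase b) := by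
  unfold lubell
  -- Erasing `b` keeps `X` in the interval exactly when `b ∉ X`, so `X` is counted `#(B \ X)` times
  -- after the exchange.
  rw [mul_sum, sum_comm' (s' := fun X => B \ X) (t' := {X ∈ F | A ⊆ X ∧ X ⊆ B})]
  · refine sum_congr rfl fun X hX => ?_
    obtain ⟨hXF, hAX, hXB⟩ := mem_filter.1 hX
    have hlt : #X < #B := card_lt_card (hXB.ssubset_of_ne fun h => hB (h ▸ hXF))
    have hle := card_le_card hAX
    have : ∀ b ∈ B \ X, ((#(B.erase b) - #A).choose (#X - #A) : ℝ)⁻¹ =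
        ((#B - #A - 1).choose (#X - #A) : ℝ)⁻¹ := by
      intro b hb
      rw [card_erase_of_mem (Finset.mem_sdiff.1 hb).1, Nat.sub_right_comm]
    rw [sum_congr rfl this, sum_const, card_sdiff_of_subset hXB, nsmul_eq_mul,
      choose_inv_mul_sub (by omega)]
    congr 2
    omega
  · intro b X
    simp only [Finset.mem_sdiff, mem_filter, subset_erase]
    constructor
    · rintro ⟨⟨h1, h2⟩, h3, h4, h5, h6⟩
      exact ⟨⟨h1, h6⟩, h3, h4, h5⟩
    · rintro ⟨⟨h1, h6⟩, h3, h4, h5⟩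
      exact ⟨⟨h1, fun h => h6 (h4 h)⟩, h3, h4, h5, h6⟩

/-- Conditioning a random chain on its first step. -/
theorem lubell_eq_sum_insert {F : Finset (Finset α)} {A B : Finset α} (hA : A ∉ F) :
    (#B - #A : ℕ) * lubell F A B = ∑ b ∈ B \ A, lubell F (insert b A) B := by
  unfold lubell
  rw [mul_sum, sum_comm' (s' := fun X => X \ A) (t' := {X ∈ F | A ⊆ X ∧ X ⊆ B})]
  · refine sum_congr rfl fun X hX => ?_
    obtain ⟨hXF, hAX, hXB⟩ := mem_filter.1 hX
    have hlt : #A < #X := card_lt_card (hAX.ssubset_of_ne fun h => hA (h ▸ hXF))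
    have hle := card_le_card hXB
    have : ∀ b ∈ X \ A, ((#B - #(insert b A)).choose (#X - #(insert b A)) : ℝ)⁻¹ =
        ((#B - #A - 1).choose (#X - #A - 1) : ℝ)⁻¹ := by
      intro b hb
      rw [card_insert_of_notMem (Finset.mem_sdiff.1 hb).2, Nat.sub_sub, Nat.sub_sub]
    rw [sum_congr rfl this, sum_const, card_sdiff_of_subset hAX, nsmul_eq_mul]
    obtain ⟨k, hk⟩ : ∃ k, #X - #A = k + 1 := ⟨#X - #A - 1, by omega⟩
    rw [hk, choose_inv_mul_self (by omega)]
    simp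
  · intro b X
    simp only [Finset.mem_sdiff, mem_filter, insert_subset_iff]
    constructor
    · rintro ⟨⟨h1, h2⟩, h3, ⟨h4, h5⟩, h6⟩
      exact ⟨⟨h4, h2⟩, h3, h5, h6⟩
    · rintro ⟨⟨h4, h2⟩, h3, h5, h6⟩
      exact ⟨⟨h6 h4, h2⟩, h3, ⟨h4, h5⟩, h6⟩

theorem lubell_self_of_notMem {F : Finset (Finset α)} {A : Finset α} (hA : A ∉ F) :
    lubell F A A = 0 := by
  unfold lubell
  rw [filter_false_of_mem, sum_empty]
  rintro X hX ⟨h1, h2⟩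
  exact hA (subset_antisymm h1 h2 ▸ hX)

/-- Partitioning the chains according to the largest member of `F` on them. -/
theorem lubell_le_of_forall_mem {F : Finset (Finset α)} {A : Finset α} {K : ℝ} (hK : 0 ≤ K) :
    ∀ B : Finset α, A ⊆ B → (∀ X ∈ F, A ⊆ X → X ⊆ B → lubell F A X ≤ K) → lubell F A B ≤ K := by
  intro B
  induction B using Finset.strongInduction with
  | H B ih =>
    intro hAB h
    by_cases hB : B ∈ F
    · exact h B hB hAB subset_rfl
    rcases hAB.eq_or_ssubset with rfl | hlt
    · rwa [lubell_self_of_notMem hB]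
    refine le_of_card_mul_eq_sum (s := B \ A) (sdiff_nonempty.2 hlt.2)
      (by rw [card_sdiff_of_subset hAB]; exact lubell_eq_sum_erase hB) fun b hb => ?_
    obtain ⟨hbB, hbA⟩ := Finset.mem_sdiff.1 hb
    exact ih _ (erase_ssubset hbB) (subset_erase.2 ⟨hAB, hbA⟩)
      fun X hX hAX hXB => h X hX hAX (hXB.trans (erase_subset _ _))

/-- Partitioning the chains according to their smallest set with property `p`. -/
theorem lubell_filter_le {F : Finset (Finset α)} {B : Finset α} (p : Finset α → Prop)
    [DecidablePred p] {K : ℝ} (hK : 0 ≤ K) (A : Finset α) (hAB : A ⊆ B)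
    (h : ∀ X, A ⊆ X → X ⊆ B → p X → lubell F X B ≤ K) : lubell {X ∈ F | p X} A B ≤ K := by
  induction hn : #B - #A generalizing A with
  | zero =>
    have hle := card_le_card hAB
    obtain rfl := eq_of_subset_of_card_le hAB (by omega)
    by_cases hp : p A
    · exact (lubell_mono (filter_subset _ _) _ _).trans (h A subset_rfl subset_rfl hp)
    · rwa [lubell_self_of_notMem (by simp [hp])]
  | succ n ih =>
    by_cases hp : p A
    · exact (lubell_mono (filter_subset _ _) _ _).trans (h A subset_rfl hAB hp)
    have hne : (B \ A).Nonempty := by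
      rw [← card_pos, card_sdiff_of_subset hAB]; omega
    refine le_of_card_mul_eq_sum hne
      (by rw [card_sdiff_of_subset hAB]; exact lubell_eq_sum_insert (by simp [hp])) fun b hb => ?_
    obtain ⟨hbB, hbA⟩ := Finset.mem_sdiff.1 hb
    refine ih _ (insert_subset hbB hAB) (fun X hX hXB => h X ((subset_insert _ _).trans hX) hXB) ?_
    rw [card_insert_of_notMem hbA]
    omega

/-- If `F` has no `w + 1` incomparable members in `[A, B]`, then each level contributes at most
`w` sets to its Lubell mass. -/
theorem lubell_le_sum_min {F : Finset (Finset α)} {A B : Finset α} (hAB : A ⊆ B) {w : ℕ}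
    (h : ¬ HasAntichain (F : Set (Finset α)) A B (w + 1)) (I : Finset ℕ)
    (hI : ∀ X ∈ F, A ⊆ X → X ⊆ B → #X - #A ∈ I) :
    lubell F A B ≤ ∑ i ∈ I, min 1 ((w : ℝ) / ((#B - #A).choose i : ℝ)) := by
  unfold lubell
  rw [← sum_fiberwise_of_maps_to (s := {X ∈ F | A ⊆ X ∧ X ⊆ B}) (t := I) (g := fun X => #X - #A)
    (fun X hX => by
      obtain ⟨h1, h2, h3⟩ := mem_filter.1 hX
      exact hI X h1 h2 h3)]
  refine sum_le_sum fun i _ => ?_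
  set G : Finset (Finset α) := {X ∈ {X ∈ F | A ⊆ X ∧ X ⊆ B} | #X - #A = i} with hG
  have hmem : ∀ X ∈ G, (X ∈ F ∧ A ⊆ X ∧ X ⊆ B) ∧ #X - #A = i := fun X hX => by
    simpa [hG] using hX
  have hsum : ∑ X ∈ G, ((#B - #A).choose (#X - #A) : ℝ)⁻¹ =
      (#G : ℝ) / ((#B - #A).choose i : ℝ) := by
    rw [sum_congr rfl fun X hX => by rw [(hmem X hX).2], sum_const, nsmul_eq_mul, div_eq_mul_inv]
  rw [hsum]
  have hcard : #G ≤ (#B - #A).choose i := by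
    rw [← card_sdiff_of_subset hAB, ← card_powersetCard]
    refine card_le_card_of_injOn (fun X => X \ A) (fun X hX => ?_) fun X hX Y hY hXY => ?_
    · obtain ⟨⟨h1, h2, h3⟩, h4⟩ := hmem X hX
      rw [mem_coe, mem_powersetCard, card_sdiff_of_subset h2]
      exact ⟨sdiff_subset_sdiff h3 subset_rfl, h4⟩
    · have h1 := (hmem X hX).1.2.1
      have h2 := (hmem Y hY).1.2.1
      rw [← sdiff_union_of_subset h1, ← sdiff_union_of_subset h2]
      exact congrArg (· ∪ A) hXY
  -- Sets of equal size are pairwise incomparable, so `w + 1` members on one level would be a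
  -- forbidden antichain.
  have hw : #G ≤ w := by
    by_contra! hlt
    obtain ⟨S, hSG, hS⟩ := exists_subset_card_eq (show w + 1 ≤ #G from hlt)
    refine h ⟨S, hS, ?_, fun X hX => by simpa using (hmem X (hSG hX)).1⟩
    intro X hX Y hY hne hXY
    have hX := hmem X (hSG hX)
    have hY := hmem Y (hSG hY)
    have e1 := card_le_card hX.1.2.1
    have e2 := card_le_card hY.1.2.1
    exact hne (eq_of_subset_of_card_le hXY (by omega))
  refine le_min (div_le_one_of_le₀ (by exact_mod_cast hcard) (by positivity)) ?_
  gcongr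

/-- Each weight is at least the reciprocal of the central binomial coefficient of the interval. -/
theorem card_le_lubell_mul (F : Finset (Finset α)) {A B : Finset α} (hAB : A ⊆ B) :
    (#{X ∈ F | A ⊆ X ∧ X ⊆ B} : ℝ) ≤
      lubell F A B * ((#B - #A).choose ((#B - #A) / 2) : ℝ) := by
  unfold lubell
  rw [sum_mul, card_eq_sum_ones, Nat.cast_sum]
  refine sum_le_sum fun X hX => ?_
  have hXB := card_le_card (mem_filter.1 hX).2.2
  have hAB := card_le_card hAB
  have h1 : 0 < (#B - #A).choose (#X - #A) := Nat.choose_pos (by omega)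
  have h2 := Nat.choose_le_middle (#X - #A) (#B - #A)
  rw [inv_mul_eq_div, le_div_iff₀ (by positivity), Nat.cast_one, one_mul]
  exact_mod_cast h2

end Lubell

/-! ### Stacks of antichains versus induced copies of the poset. -/

section Stack
open Finset

variable {α : Type*}

/-- Above `A` there are antichains of members of `F` of the prescribed sizes, separated from each
other by an increasing sequence of sets. -/
def HasStack (F : Set (Finset α)) : List ℕ → Finset α → Prop
  | [], _ => True
  | s :: ℓ, A => ∃ X, A ⊆ X ∧ HasAntichain F A X s ∧ HasStack F ℓ X

/-- The union of the images of a level serves as separator: every image from a higher level contains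
it. The hypotheses are weaker than an order embedding so that they pass to the poset without its
lowest level. -/
theorem hasStack_of_monotone {F : Set (Finset α)} [DecidableEq α] :
    ∀ (ℓ : List ℕ) (A : Finset α) (f : CompleteMultilevel ℓ → Finset α),
      (∀ x, f x ∈ F ∧ A ⊆ f x) → (∀ x y, x.level < y.level → f x ⊆ f y) →
      (∀ x y, x.level = y.level → f x ⊆ f y → x = y) → HasStack F ℓ A
  | [], _, _, _, _, _ => trivial
  | s :: ℓ, A, f, h1, h2, h3 => by
    let e : Fin s → CompleteMultilevel (s :: ℓ) := fun h => ⟨0, h⟩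
    let u : CompleteMultilevel ℓ → CompleteMultilevel (s :: ℓ) := fun x => ⟨x.level.succ, x.pos⟩
    have he : ∀ h h', f (e h) ⊆ f (e h') → h = h' := fun h h' hh => by
      injection h3 (e h) (e h') rfl hh 
    refine ⟨A ∪ univ.sup (fun h => f (e h)), subset_union_left,
      ⟨univ.image fun h => f (e h), ?_, ?_, ?_⟩, hasStack_of_monotone ℓ _ (fun x => f (u x)) ?_ ?_ ?_⟩
    · rw [card_image_of_injective _ fun h h' hh => he h h' (le_of_eq hh), card_fin]
    · intro X hX Y hY hne hXY
      simp only [coe_image, coe_univ, Set.image_univ, Set.mem_range] at hX hY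
      obtain ⟨h, rfl⟩ := hX
      obtain ⟨h', rfl⟩ := hY
      exact hne (by rw [he _ _ hXY])
    · intro X hX
      obtain ⟨h, -, rfl⟩ := mem_image.1 hX
      exact ⟨(h1 _).1, (h1 _).2, (Finset.le_sup (f := fun h => f (e h)) (mem_univ h)).trans
        subset_union_right⟩
    · refine fun x => ⟨(h1 _).1, union_subset (h1 _).2 (Finset.sup_le fun h _ => ?_)⟩
      exact h2 _ _ (Fin.succ_pos _)
    · exact fun x y hxy => h2 _ _ (Fin.succ_lt_succ_iff.2 hxy)
    · intro x y hxy hf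
      have := h3 (u x) (u y) (congrArg Fin.succ hxy) hf
      obtain ⟨i, p⟩ := x
      obtain ⟨j, q⟩ := y
      obtain rfl : i = j := hxy
      simpa [u] using this

theorem hasStack_of_orderEmbedding {n : ℕ} {F : Set (Finset (Fin n))} {ℓ : List ℕ}
    (i : CompleteMultilevel ℓ ↪o Finset (Fin n)) (hi : ∀ p, i p ∈ F) : HasStack F ℓ ∅ := by
  refine hasStack_of_monotone ℓ ∅ i (fun x => ⟨hi x, empty_subset _⟩)
    (fun x y hxy => i.le_iff_le.2 (Or.inr hxy)) fun x y hxy hf => ?_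
  exact (i.le_iff_le.1 hf).resolve_right hxy.not_lt

/-- Two successive singleton levels could be represented by the same set; a level of size at least
two on one side of each separator forces strict inclusions. The clause `¬ f x ⊆ A` carries this
through the induction when the lower of the two levels is a singleton. -/
theorem exists_strictMono_of_hasStack {F : Set (Finset α)} :
    ∀ (ℓ : List ℕ) (A : Finset α), ℓ.IsChain (fun a b => 2 ≤ a ∨ 2 ≤ b) → (∀ s ∈ ℓ, 1 ≤ s) →
      HasStack F ℓ A →
      ∃ f : CompleteMultilevel ℓ → Finset α, (∀ x, f x ∈ F ∧ A ⊆ f x) ∧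
        ((∀ s ∈ ℓ.head?, 2 ≤ s) → ∀ x, ¬ f x ⊆ A) ∧
        (∀ x y, x.level < y.level → f x ⊂ f y) ∧
        (∀ x y, x.level = y.level → f x ⊆ f y → x = y)
  | [], _, _, _, _ => ⟨fun x => x.level.elim0, fun x => x.level.elim0, fun _ x => x.level.elim0,
      fun x => x.level.elim0, fun x => x.level.elim0⟩
  | s :: ℓ, A, hc, hpos, ⟨X, hAX, ⟨S, hS, hanti, hmem⟩, hX⟩ => by
    rw [List.isChain_cons] at hc
    obtain ⟨f, h1, h2, h3, h4⟩ := exists_strictMono_of_hasStack ℓ X hc.2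
      (fun a ha => hpos a (List.mem_cons_of_mem _ ha)) hX
    let e : Fin s ≃ S := (S.equivFinOfCardEq hS).symm
    have he : ∀ h h', (e h : Finset α) ⊆ e h' → h = h' := fun h h' hh => by
      by_contra hne
      exact hanti (e h).2 (e h').2 (fun h => hne (e.injective (Subtype.ext h))) hh
    -- A set containing two incomparable sets lies inside neither of them.
    have he2 : 2 ≤ s → ∀ h Z, (∀ h', (e h' : Finset α) ⊆ Z) → ¬ Z ⊆ e h := fun hs h Z hZ hh => by
      have : Nontrivial (Fin s) := Fin.nontrivial_iff_two_le.2 hs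
      obtain ⟨h', hne⟩ := exists_ne h
      exact hne (he _ _ ((hZ h').trans hh))
    have heX : ∀ h, (e h : Finset α) ⊆ X := fun h => (hmem _ (e h).2).2.2
    -- The type of the position depends on the level, so the map is defined by cases on the level
    -- first.
    let g : (i : Fin (s :: ℓ).length) → Fin ((s :: ℓ).get i) → Finset α :=
      Fin.cases (fun h => (e h : Finset α)) fun i h => f ⟨i, h⟩
    have hg : ∀ (P : CompleteMultilevel (s :: ℓ) → Prop), (∀ h : Fin s, P ⟨0, h⟩) →
        (∀ x : CompleteMultilevel ℓ, P ⟨x.level.succ, x.pos⟩) → ∀ x, P x := by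
      rintro P hP0 hP1 ⟨i, p⟩
      induction i using Fin.cases with
      | zero => exact hP0 p
      | succ i => exact hP1 ⟨i, p⟩
    refine ⟨fun x => g x.level x.pos, ?_, ?_, ?_, ?_⟩
    · refine hg _ (fun h => ⟨(hmem _ (e h).2).1, (hmem _ (e h).2).2.1⟩) fun x => ?_
      exact ⟨(h1 x).1, hAX.trans (h1 x).2⟩
    · intro hs
      replace hs : 2 ≤ s := hs s rfl
      refine hg _ (fun h hle => ?_) fun x hle => ?_
      · have : Nontrivial (Fin s) := Fin.nontrivial_iff_two_le.2 hs
        obtain ⟨h', hne⟩ := exists_ne h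
        exact hne (he _ _ (hle.trans (hmem _ (e h').2).2.1)).symm
      · exact he2 hs ⟨0, by omega⟩ (f x) (fun h' => (heX h').trans (h1 x).2)
          (hle.trans (hmem _ (e ⟨0, by omega⟩).2).2.1)
    · refine hg _ (fun h => ?_) fun x => ?_
      · refine hg _ (fun h' hlt => absurd hlt (lt_irrefl _)) fun y _ => ?_
        refine ⟨(heX h).trans (h1 y).2, fun hle => ?_⟩
        by_cases hs : 2 ≤ s
        · exact he2 hs h (f y) (fun h' => (heX h').trans (h1 y).2) hle
        · exact h2 (fun b hb => (hc.1 b hb).resolve_left hs) y (hle.trans (heX h))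
      · refine hg _ (fun h' hlt => absurd hlt (Fin.not_lt_zero _)) fun y hlt => ?_
        exact h3 x y (Fin.succ_lt_succ_iff.1 hlt)
    · refine hg _ (fun h => ?_) fun x => ?_
      · refine hg _ (fun h' _ hle => ?_) fun y hlt => ?_
        · rw [he h h' hle]
        · exact absurd hlt (Fin.succ_ne_zero _).symm
      · refine hg _ (fun h' hlt => absurd hlt (Fin.succ_ne_zero _)) fun y hlt hle => ?_
        have := h4 x y (Fin.succ_injective _ hlt) hle
        rw [this]

theorem not_inducedFree_of_hasStack {n : ℕ} {F : Set (Finset (Fin n))} {ℓ : List ℕ}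
    (hc : ℓ.IsChain (fun a b => 2 ≤ a ∨ 2 ≤ b)) (hpos : ∀ s ∈ ℓ, 1 ≤ s) (h : HasStack F ℓ ∅) :
    ¬ InducedFree (CompleteMultilevel ℓ) F := by
  obtain ⟨f, h1, -, h3, h4⟩ := exists_strictMono_of_hasStack ℓ ∅ hc hpos h
  refine not_not_intro ⟨OrderEmbedding.ofMapLEIff f fun x y => ⟨fun hle => ?_, ?_⟩, fun x => (h1 x).1⟩
  · rcases lt_trichotomy x.level y.level with hlt | heq | hgt
    · exact Or.inr hlt
    · exact Or.inl (h4 x y heq hle)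
    · exact absurd hle (h3 y x hgt).2
  · rintro (rfl | hlt)
    · exact le_rfl
    · exact (h3 x y hlt).1

variable [DecidableEq α] [Fintype α]

/-- Members with no `s`-antichain below them are handled by conditioning on the largest such member
of the chain, the others by conditioning on the first set of the chain with such an antichain below
it: above that set the rest of the stack cannot exist. In `h1` it matters that `X` is a member,
since this bounds its size from below. -/
theorem lubell_le_add_of_not_hasStack {F : Finset (Finset α)} {s : ℕ} {ℓ : List ℕ} {A : Finset α}
    {K K' : ℝ} (hK : 0 ≤ K) (hK' : 0 ≤ K')
    (h1 : ∀ X ∈ F, A ⊆ X → ¬ HasAntichain (F : Set (Finset α)) A X s → lubell F A X ≤ K)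
    (h2 : ∀ X, A ⊆ X → ¬ HasStack (F : Set (Finset α)) ℓ X → lubell F X univ ≤ K')
    (h : ¬ HasStack (F : Set (Finset α)) (s :: ℓ) A) : lubell F A univ ≤ K + K' := by
  classical
  rw [← lubell_filter_add_filter_not F (fun X => HasAntichain (F : Set (Finset α)) A X s), add_comm]
  refine add_le_add (lubell_le_of_forall_mem hK _ (subset_univ _) fun X hX hAX _ => ?_)
    (lubell_filter_le _ hK' _ (subset_univ _) fun X hAX _ hX =>
      h2 X hAX fun hst => h ⟨X, hAX, hX, hst⟩)
  obtain ⟨hXF, hX⟩ := mem_filter.1 hX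
  exact (lubell_mono (filter_subset _ _) _ _).trans (h1 X hXF hAX hX)

theorem lubell_le_of_not_hasStack {F : Finset (Finset α)} {M : ℕ → ℝ} {t : ℕ} {K : ℝ}
    (hM : ∀ s, 0 ≤ M s) (hK : 0 ≤ K)
    (ht : ∀ A, ¬ HasAntichain (F : Set (Finset α)) A univ t → lubell F A univ ≤ K) :
    ∀ (ss : List ℕ), (∀ s ∈ ss, ∀ A X : Finset α, A ⊆ X →
        ¬ HasAntichain (F : Set (Finset α)) A X s → lubell F A X ≤ M s) →
      ∀ A, ¬ HasStack (F : Set (Finset α)) (ss ++ [t]) A → lubell F A univ ≤ (ss.map M).sum + K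
  | [], _, A, h => by
    simp only [List.map_nil, List.sum_nil, zero_add]
    exact ht A fun hA => h ⟨univ, subset_univ _, hA, trivial⟩
  | s :: ss, hss, A, h => by
    rw [List.map_cons, List.sum_cons, add_assoc]
    refine lubell_le_add_of_not_hasStack (hM s)
      (add_nonneg (List.sum_nonneg (by simpa using fun a _ => hM a)) hK)
      (fun X _ hAX hX => hss s List.mem_cons_self A X hAX hX)
      (fun X _ hX => lubell_le_of_not_hasStack hM hK ht ss
        (fun a ha => hss a (List.mem_cons_of_mem _ ha)) X hX) h

end Stack

/-! ### Monotonicity of the capped level sums, and estimates of binomial coefficients. -/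

section Binomial
open Finset

/-- Together the hypotheses say that `j` is at least as close to `N / 2` as `i`, on either side. -/
theorem choose_le_choose_of_add_le {N i j : ℕ} (hij : i ≤ j) (h : i + j ≤ N) :
    N.choose i ≤ N.choose j := by
  have key : ∀ {i j : ℕ}, i ≤ j → 2 * j ≤ N → N.choose i ≤ N.choose j := by
    intro i j hij h
    induction j, hij using Nat.le_induction with
    | base => exact le_rfl
    | succ j hij ih =>
      exact (ih (by omega)).trans (Nat.choose_le_succ_of_lt_half_left (by omega))
  by_cases hj : 2 * j ≤ N
  · exact key hij hj
  · rw [← Nat.choose_symm (by omega : j ≤ N)]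
    exact key (by omega) (by omega)

/-- The largest possible Lubell mass of a family with at most `w` sets on each level of the
Boolean lattice of dimension `N`. -/
noncomputable def capSum (w N : ℕ) : ℝ :=
  ∑ i ∈ range (N + 1), min 1 ((w : ℝ) / (N.choose i : ℝ))

theorem capSum_le_succ (w N : ℕ) : capSum w N ≤ N + 1 := by
  have := sum_le_card_nsmul (range (N + 1)) (fun i => min 1 ((w : ℝ) / (N.choose i : ℝ))) 1
    fun i _ => min_le_left _ _
  simpa [capSum] using this

theorem min_div_choose_succ_le (w : ℕ) {N i : ℕ} (hi : i ≤ N) :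
    min 1 ((w : ℝ) / ((N + 1).choose i : ℝ)) ≤ min 1 ((w : ℝ) / (N.choose i : ℝ)) := by
  have : 0 < N.choose i := Nat.choose_pos hi
  gcongr
  omega

theorem min_div_choose_succ_succ_le (w : ℕ) {N i : ℕ} (hi : i ≤ N) :
    min 1 ((w : ℝ) / ((N + 1).choose (i + 1) : ℝ)) ≤ min 1 ((w : ℝ) / (N.choose i : ℝ)) := by
  have : 0 < N.choose i := Nat.choose_pos hi
  gcongr
  rw [Nat.choose_succ_succ]
  omega

/-- By Pascal's rule, levels below `j - 1` of dimension `N + 1` are dominated by the same levels of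
dimension `N`, and levels above `j + 1` by the levels one lower. Only three middle levels against
two remain to be compared. -/
theorem capSum_succ_le_of_middle {w N j : ℕ} (hj : 1 ≤ j) (hjN : j ≤ N)
    (h : min 1 ((w : ℝ) / ((N + 1).choose (j - 1) : ℝ)) + min 1 ((w : ℝ) / ((N + 1).choose j : ℝ))
      + min 1 ((w : ℝ) / ((N + 1).choose (j + 1) : ℝ)) ≤
      min 1 ((w : ℝ) / (N.choose (j - 1) : ℝ)) + min 1 ((w : ℝ) / (N.choose j : ℝ))) :
    capSum w (N + 1) ≤ capSum w N := by
  obtain ⟨j, rfl⟩ : ∃ k, j = k + 1 := ⟨j - 1, by omega⟩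
  unfold capSum
  have e1 : N + 1 + 1 = (j + 1 + 1 + 1) + (N - (j + 1)) := by omega
  have e2 : N + 1 = (j + 1 + 1) + (N - (j + 1)) := by omega
  rw [e1, sum_range_add, sum_range_succ, sum_range_succ, sum_range_succ]
  conv_rhs => rw [e2, sum_range_add, sum_range_succ, sum_range_succ]
  have h1 : ∑ i ∈ range j, min 1 ((w : ℝ) / ((N + 1).choose i : ℝ)) ≤
      ∑ i ∈ range j, min 1 ((w : ℝ) / (N.choose i : ℝ)) :=
    sum_le_sum fun i hi => min_div_choose_succ_le w (by have := mem_range.1 hi; omega)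
  have h2 : ∑ i ∈ range (N - (j + 1)), min 1 ((w : ℝ) / ((N + 1).choose (j + 1 + 1 + 1 + i) : ℝ)) ≤
      ∑ i ∈ range (N - (j + 1)), min 1 ((w : ℝ) / (N.choose (j + 1 + 1 + i) : ℝ)) :=
    sum_le_sum fun i hi => by
      have := mem_range.1 hi
      rw [show j + 1 + 1 + 1 + i = j + 1 + 1 + i + 1 by omega]
      exact min_div_choose_succ_succ_le w (by omega)
  simp only [Nat.add_sub_cancel, Nat.add_assoc, Nat.reduceAdd] at h h2 ⊢
  linarith

/-- With `x` the common value on the two middle levels of dimension `2 * h + 1`, the new central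
level gives `x / 2` and its two neighbours at most `3 * x / 4` each, in total at most `2 * x`. -/
theorem capSum_succ_le_of_odd {w h : ℕ} (hh : 1 ≤ h) (hw : w ≤ (2 * h + 1).choose h) :
    capSum w (2 * h + 1 + 1) ≤ capSum w (2 * h + 1) := by
  refine capSum_succ_le_of_middle (j := h + 1) (by omega) (by omega) ?_
  rw [Nat.add_sub_cancel]
  have hc : 0 < (2 * h + 1).choose h := Nat.choose_pos (by omega)
  have e0 : (2 * h + 1).choose (h + 1) = (2 * h + 1).choose h :=
    Nat.choose_symm_of_eq_add (by omega)
  have e1 : (2 * h + 1 + 1).choose (h + 1) = 2 * (2 * h + 1).choose h := by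
    rw [Nat.choose_succ_succ, e0]; omega
  have e2 : (2 * h + 1 + 1).choose (h + 1 + 1) = (2 * h + 1 + 1).choose h :=
    Nat.choose_symm_of_eq_add (by omega)
  have e3 := Nat.choose_succ_right_eq (2 * h + 1 + 1) h
  rw [e1, show 2 * h + 1 + 1 - h = h + 2 by omega] at e3
  have e4 : 2 * ((2 * h + 1).choose h : ℝ) * (h + 1) = ((2 * h + 1 + 1).choose h : ℝ) * (h + 2) := by
    exact_mod_cast e3
  rw [e0, e1, e2]
  have hd : 0 < (2 * h + 1 + 1).choose h := Nat.choose_pos (by omega)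
  have hcR : (0 : ℝ) < ((2 * h + 1).choose h : ℝ) := by exact_mod_cast hc
  have hle : (w : ℝ) / ((2 * h + 1).choose h : ℝ) ≤ 1 :=
    div_le_one_of_le₀ (by exact_mod_cast hw) (by positivity)
  have hhR : (1 : ℝ) ≤ h := by exact_mod_cast hh
  rw [min_eq_right hle]
  set x := (w : ℝ) / ((2 * h + 1).choose h : ℝ) with hx
  have hx0 : 0 ≤ x := by positivity
  have f1 : (w : ℝ) / ((2 * (2 * h + 1).choose h : ℕ) : ℝ) = x / 2 := by
    rw [hx]; push_cast; field_simp
  have f2 : (w : ℝ) / ((2 * h + 1 + 1).choose h : ℝ) = x * ((h + 2) / (2 * (h + 1))) := by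
    rw [hx]
    have : (0 : ℝ) < ((2 * h + 1 + 1).choose h : ℝ) := by exact_mod_cast hd
    field_simp
    linear_combination (w : ℝ) * e4
  have f3 : ((h : ℝ) + 2) / (2 * (h + 1)) ≤ 3 / 4 := by
    rw [div_le_div_iff₀ (by positivity) (by norm_num)]
    linarith
  rw [f1, f2]
  have g1 := min_le_right 1 (x * (((h : ℝ) + 2) / (2 * (h + 1))))
  have g2 := min_le_right 1 (x / 2)
  have g3 := mul_le_mul_of_nonneg_left f3 hx0
  linarith

/-- If the cap is inactive on level `h - 1` of dimension `2 * h`, the three terms compare for all `h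
≥ 2`. If it is active, the coefficient of `x` on the left must be at most `2`, which needs `h ≥ 4`;
hence the alternative `hor`. -/
theorem capSum_succ_le_of_even {w h : ℕ} (hh : 2 ≤ h) (hw : w ≤ (2 * h).choose h)
    (hor : 4 ≤ h ∨ w ≤ (2 * h).choose (h - 1)) :
    capSum w (2 * h + 1) ≤ capSum w (2 * h) := by
  refine capSum_succ_le_of_middle (j := h) (by omega) (by omega) ?_
  obtain ⟨k, rfl⟩ : ∃ k, h = k + 1 := ⟨h - 1, by omega⟩
  simp only [Nat.add_sub_cancel] at hor ⊢
  have hc : (0 : ℝ) < ((2 * (k + 1)).choose (k + 1) : ℝ) := by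
    exact_mod_cast Nat.choose_pos (by omega)
  have e1 : (2 * (k + 1) + 1).choose (k + 1 + 1) = (2 * (k + 1) + 1).choose (k + 1) :=
    Nat.choose_symm_of_eq_add (by omega)
  have e2 := Nat.choose_succ_right_eq (2 * (k + 1)) k
  have e3 := Nat.choose_succ_right_eq (2 * (k + 1) + 1) k
  have e4 := Nat.choose_mul_succ_eq (2 * (k + 1)) (k + 1)
  rw [show 2 * (k + 1) - k = k + 2 by omega] at e2
  rw [show 2 * (k + 1) + 1 - k = k + 3 by omega] at e3
  rw [show 2 * (k + 1) + 1 - (k + 1) = k + 2 by omega] at e4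
  rw [e1]
  have hle : (w : ℝ) / ((2 * (k + 1)).choose (k + 1) : ℝ) ≤ 1 :=
    div_le_one_of_le₀ (by exact_mod_cast hw) hc.le
  rw [min_eq_right hle]
  set c := ((2 * (k + 1)).choose (k + 1) : ℝ) with hcdef
  have e2' : c * (k + 1) = ((2 * (k + 1)).choose k : ℝ) * (k + 2) := by
    rw [hcdef]; exact_mod_cast e2
  have e3' : ((2 * (k + 1) + 1).choose (k + 1) : ℝ) * (k + 1) =
      ((2 * (k + 1) + 1).choose k : ℝ) * (k + 3) := by exact_mod_cast e3
  have e4' : c * (2 * (k + 1) + 1) = ((2 * (k + 1) + 1).choose (k + 1) : ℝ) * (k + 2) := by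
    rw [hcdef]; exact_mod_cast e4
  have p1 : (0 : ℝ) < ((2 * (k + 1)).choose k : ℝ) := by exact_mod_cast Nat.choose_pos (by omega)
  have p2 : (0 : ℝ) < ((2 * (k + 1) + 1).choose k : ℝ) := by
    exact_mod_cast Nat.choose_pos (by omega)
  have p3 : (0 : ℝ) < ((2 * (k + 1) + 1).choose (k + 1) : ℝ) := by
    exact_mod_cast Nat.choose_pos (by omega)
  set x := (w : ℝ) / c with hx
  have hx0 : 0 ≤ x := by positivity
  have hkR : (1 : ℝ) ≤ k := by exact_mod_cast (by omega : 1 ≤ k)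
  have f1 : (w : ℝ) / ((2 * (k + 1)).choose k : ℝ) = x * ((k + 2) / (k + 1)) := by
    rw [hx]
    field_simp
    linear_combination (w : ℝ) * e2'
  have f2 : (w : ℝ) / ((2 * (k + 1) + 1).choose (k + 1) : ℝ) = x * ((k + 2) / (2 * k + 3)) := by
    rw [hx]
    field_simp
    linear_combination (w : ℝ) * e4'
  have f3 : (w : ℝ) / ((2 * (k + 1) + 1).choose k : ℝ) =
      x * ((k + 2) * (k + 3) / ((k + 1) * (2 * k + 3))) := by
    have : (w : ℝ) / ((2 * (k + 1) + 1).choose k : ℝ) =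
        (w : ℝ) / ((2 * (k + 1) + 1).choose (k + 1) : ℝ) * ((k + 3) / (k + 1)) := by
      field_simp
      linear_combination (w : ℝ) * e3'
    rw [this, f2]
    field_simp
  rw [f1, f2, f3]
  have g2 := min_le_right 1 (x * (((k : ℝ) + 2) / (2 * k + 3)))
  have g3 := min_le_right 1 (x * (((k : ℝ) + 2) * (k + 3) / ((k + 1) * (2 * k + 3))))
  by_cases hcase : x * (((k : ℝ) + 2) / (k + 1)) ≤ 1
  · rw [min_eq_right hcase]
    have : ((k : ℝ) + 2) * (k + 3) / ((k + 1) * (2 * k + 3)) + 2 * ((k + 2) / (2 * k + 3)) ≤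
        (k + 2) / (k + 1) + 1 := by
      rw [← sub_nonneg]
      have : ((k : ℝ) + 2) / (k + 1) + 1 -
          ((k + 2) * (k + 3) / ((k + 1) * (2 * k + 3)) + 2 * ((k + 2) / (2 * k + 3))) =
          (k ^ 2 + k - 1) / ((k + 1) * (2 * k + 3)) := by
        field_simp
        ring
      rw [this]
      exact div_nonneg (by nlinarith) (by positivity)
    have := mul_le_mul_of_nonneg_left this hx0
    linarith
  · have hk3 : (3 : ℝ) ≤ k := by
      rcases hor with hor | hor
      · exact_mod_cast (by omega : 3 ≤ k)
      · refine absurd ?_ hcase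
        rw [← f1]
        exact div_le_one_of_le₀ (by exact_mod_cast hor) p1.le
    rw [min_eq_left (not_le.1 hcase).le]
    have : ((k : ℝ) + 2) * (k + 3) / ((k + 1) * (2 * k + 3)) + 2 * ((k + 2) / (2 * k + 3)) ≤ 2 := by
      rw [← sub_nonneg]
      have : (2 : ℝ) -
          ((k + 2) * (k + 3) / ((k + 1) * (2 * k + 3)) + 2 * ((k + 2) / (2 * k + 3))) =
          (k ^ 2 - k - 4) / ((k + 1) * (2 * k + 3)) := by
        field_simp
        ring
      rw [this]
      exact div_nonneg (by nlinarith) (by positivity)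
    have := mul_le_mul_of_nonneg_left this hx0
    linarith

theorem capSum_anti {w m : ℕ} (hm : 8 ≤ m ∨ 4 ≤ m ∧ w ≤ m) (hw : w ≤ m.choose (m / 2)) {N : ℕ}
    (hN : m ≤ N) : capSum w N ≤ capSum w m := by
  induction N, hN using Nat.le_induction with
  | base => exact le_rfl
  | succ N hN ih =>
    refine le_trans ?_ ih
    have hwN : w ≤ N.choose (N / 2) :=
      hw.trans ((Nat.choose_le_choose _ hN).trans (Nat.choose_le_middle _ _))
    rcases Nat.even_or_odd' N with ⟨h, rfl | rfl⟩
    · rw [Nat.mul_div_cancel_left _ (by norm_num)] at hwN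
      refine capSum_succ_le_of_even (by omega) hwN ?_
      rcases hm with hm | ⟨hm, hwm⟩
      · left; omega
      · right
        have := choose_le_choose_of_add_le (N := 2 * h) (i := 1) (j := h - 1) (by omega) (by omega)
        rw [Nat.choose_one_right] at this
        omega
    · rw [show (2 * h + 1) / 2 = h by omega] at hwN
      exact capSum_succ_le_of_odd (by omega) hwN

/-- Binomial coefficients near the middle are close to the central one. -/
theorem one_sub_mul_le_choose {n i j : ℕ} (h1 : n ≤ 2 * i + 2 * j) (h2 : 2 * i ≤ n + 2 * j)
    (hi : i ≤ n) : (1 - 2 * j * (j + 1) / n : ℝ) * (n.choose (n / 2) : ℝ) ≤ (n.choose i : ℝ) := by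
  -- The step from distance `j` to `j + 1` loses at most `4 * (j + 1) / n` of the central
  -- coefficient, and these losses add up to `2 * j * (j + 1) / n`.
  have key : ∀ j : ℕ, j ≤ n / 2 →
      n * n.choose (n / 2) ≤ n * n.choose (n / 2 - j) + 2 * j * (j + 1) * n.choose (n / 2) := by
    intro j
    induction j with
    | zero => simp
    | succ j ih =>
      intro hj
      have h := ih (by omega)
      have e := Nat.choose_succ_right_eq n (n / 2 - (j + 1))
      obtain ⟨k, hk⟩ : ∃ k, n / 2 = k + (j + 1) := ⟨n / 2 - (j + 1), by omega⟩
      have hk' : n / 2 - j = k + 1 := by omega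
      have hmid := Nat.choose_le_middle (n / 2 - j) n
      rw [show n / 2 - (j + 1) = k by omega] at e ⊢
      rw [hk'] at h hmid
      obtain ⟨l, hl⟩ : ∃ l, n = k + l := ⟨n - k, by omega⟩
      rw [show n - k = l by omega] at e
      have hl1 : n ≤ 2 * l := by omega
      have hl2 : l ≤ k + 1 + (2 * j + 2) := by omega
      -- `l * (C (k + 1) - C k) = (l - (k + 1)) * C (k + 1)`
      have : l * n.choose (k + 1) ≤ l * n.choose k + (2 * j + 2) * n.choose (n / 2) := by
        calc l * n.choose (k + 1) ≤ (k + 1 + (2 * j + 2)) * n.choose (k + 1) := by gcongr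
          _ = n.choose (k + 1) * (k + 1) + (2 * j + 2) * n.choose (k + 1) := by ring
          _ ≤ l * n.choose k + (2 * j + 2) * n.choose (n / 2) := by
            rw [e, mul_comm l]; gcongr
      have h3 : n * n.choose (k + 1) ≤ n * n.choose k + 4 * (j + 1) * n.choose (n / 2) := by
        rcases le_total (n.choose (k + 1)) (n.choose k) with hle | hle
        · exact (Nat.mul_le_mul_left n hle).trans (Nat.le_add_right _ _)
        · obtain ⟨d, hd⟩ := Nat.exists_eq_add_of_le hle
          rw [hd] at this ⊢
          have h4 : l * d ≤ (2 * j + 2) * n.choose (n / 2) := by nlinarith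
          have h5 : n * d ≤ 2 * l * d := Nat.mul_le_mul_right _ hl1
          nlinarith
      calc n * n.choose (n / 2) ≤ n * n.choose (k + 1) + 2 * j * (j + 1) * n.choose (n / 2) := h
        _ ≤ n * n.choose k + 4 * (j + 1) * n.choose (n / 2)
            + 2 * j * (j + 1) * n.choose (n / 2) := by gcongr
        _ = _ := by ring
  obtain ⟨j', hj', hjj, he⟩ : ∃ j', j' ≤ n / 2 ∧ j' ≤ j ∧ n.choose i = n.choose (n / 2 - j') := by
    by_cases hin : i ≤ n / 2
    · exact ⟨n / 2 - i, by omega, by omega, by congr 1; omega⟩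
    · refine ⟨n / 2 - (n - i), by omega, by omega, ?_⟩
      rw [← Nat.choose_symm hi]
      congr 1
      omega
  rcases Nat.eq_zero_or_pos n with rfl | hn
  · obtain rfl : i = 0 := by omega
    simp
  have h := key j' hj'
  rw [← he] at h
  have h' : (n : ℝ) * n.choose (n / 2) ≤ n * n.choose i + 2 * j * (j + 1) * n.choose (n / 2) := by
    have : n * n.choose (n / 2) ≤ n * n.choose i + 2 * j * (j + 1) * n.choose (n / 2) :=
      h.trans (by gcongr)
    exact_mod_cast this
  have hnR : (0 : ℝ) < n := by exact_mod_cast hn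
  rw [one_sub_div hnR.ne', div_mul_eq_mul_div, div_le_iff₀ hnR]
  linarith

/-- Far from the middle, binomial coefficients are exponentially smaller than the central one. -/
theorem choose_le_pow_mul {n K i : ℕ} (hK : 2 ≤ K) (hn : K ≤ n) (hi : i < n / 2 - 2 * (n / K)) :
    (n.choose i : ℝ) ≤ (1 - 1 / K : ℝ) ^ (n / K) * (n.choose (n / 2) : ℝ) := by
  have hKR : (2 : ℝ) ≤ K := by exact_mod_cast hK
  have hq : (0 : ℝ) ≤ 1 - 1 / K := by
    rw [sub_nonneg, div_le_one (by linarith)]; linarith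
  -- Below `n / 2 - n / K` consecutive coefficients have ratio at most `1 - 1 / K`. The index `i`
  -- lies a further `n / K` lower, which yields that many factors.
  have step : ∀ j, j + 1 ≤ n / 2 - n / K →
      (n.choose j : ℝ) ≤ (1 - 1 / K : ℝ) * (n.choose (j + 1) : ℝ) := by
    intro j hj
    have e := Nat.choose_succ_right_eq n j
    obtain ⟨l, hl⟩ : ∃ l, n = j + l := ⟨n - j, by omega⟩
    rw [show n - j = l by omega] at e
    have e' : (n.choose (j + 1) : ℝ) * (j + 1) = n.choose j * l := by exact_mod_cast e
    have hdiv : (n : ℝ) < K * ((n / K : ℕ) + 1) := by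
      exact_mod_cast Nat.lt_mul_div_succ n (by omega : 0 < K)
    have hle : 2 * ((j : ℝ) + 1) + 2 * ((n / K : ℕ) : ℝ) ≤ n := by
      have : 2 * (j + 1) + 2 * (n / K) ≤ n := by omega
      exact_mod_cast this
    have hlR : (n : ℝ) = j + l := by exact_mod_cast hl
    have hnR : (K : ℝ) ≤ n := by exact_mod_cast hn
    have hl0 : (0 : ℝ) < l := by
      have : 0 < l := by omega
      exact_mod_cast this
    have hmul : (K : ℝ) * (j + 1) ≤ (K - 1) * l := by
      nlinarith
    have hC : (0 : ℝ) ≤ n.choose (j + 1) := by positivity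
    rw [← mul_le_mul_iff_left₀ hl0, ← e', one_sub_div (by linarith), div_mul_eq_mul_div,
      div_mul_eq_mul_div, le_div_iff₀ (by linarith)]
    nlinarith
  have iter : ∀ l, i + l ≤ n / 2 - n / K →
      (n.choose i : ℝ) ≤ (1 - 1 / K : ℝ) ^ l * (n.choose (i + l) : ℝ) := by
    intro l
    induction l with
    | zero => simp
    | succ l ih =>
      intro hl
      rw [pow_succ, mul_assoc]
      refine (ih (by omega)).trans ?_
      gcongr
      exact step _ (by omega)
  refine (iter (n / K) (by omega)).trans ?_
  gcongr
  exact_mod_cast Nat.choose_le_middle _ _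

end Binomial

/-! ### Mass bounds for the middle and the end intervals. -/

section Bounds
open Finset

/-- Below dimension `m` there are at most `m` levels in all; from `m` on the sum decreases. -/
theorem capSum_le_of_middle {w m : ℕ} (hm : 8 ≤ m ∨ 4 ≤ m ∧ w ≤ m) (hw : w ≤ m.choose (m / 2))
    {M : ℝ} (hM : (m : ℝ) ≤ M) (h : capSum w m ≤ M) (N : ℕ) : capSum w N ≤ M := by
  rcases lt_or_ge N m with hlt | hge
  · have : (N : ℝ) + 1 ≤ m := by exact_mod_cast hlt
    linarith [capSum_le_succ w N]
  · exact (capSum_anti hm hw hge).trans h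

/-- In dimension `4` the sum is `1 + 3/4 + 1/2 + 3/4 + 1 = 4`, with nothing to spare. -/
theorem capSum_three_le (N : ℕ) : capSum 3 N ≤ 4 := by
  refine capSum_le_of_middle (m := 4) (by omega) (by decide) (by norm_num) ?_ N
  norm_num [capSum, sum_range_succ, Nat.choose]

theorem mStar_four : mStar 4 = 4 := by
  refine (mStar_isLeast 4).unique ⟨by decide, fun m hm => ?_⟩
  by_contra! hlt
  interval_cases m <;> revert hm <;> decide

theorem choose_add_one_div_two (n : ℕ) : n.choose ((n + 1) / 2) = n.choose (n / 2) :=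
  Nat.choose_symm_of_eq_add (by omega)

theorem le_choose_mStar (s : ℕ) : s ≤ (mStar s).choose (mStar s / 2) := by
  rw [← choose_add_one_div_two]
  exact (mStar_isLeast s).1

theorem le_mStar {M s : ℕ} (hs : 2 ^ M < s) : M ≤ mStar s := by
  by_contra! hlt
  have h1 := (le_choose_mStar s).trans (Nat.choose_le_two_pow _ _)
  have h2 := Nat.pow_le_pow_right (show 0 < 2 by norm_num) hlt.le
  omega

/-- The `m + 1` levels give at most one each. On `2 * q` middle levels the term is at most `(1 + c)
/ 2`, which saves `q * (1 - c) ≥ 1` altogether. -/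
theorem exists_capSum_middle_le {c : ℝ} (hc0 : 0 < c) (hc : c < 1) :
    ∃ m₀ : ℕ, ∀ m w : ℕ, m₀ ≤ m → (w : ℝ) ≤ c * (m.choose (m / 2) : ℝ) → capSum w m ≤ m := by
  obtain ⟨q, hq⟩ := exists_nat_ge (1 / (1 - c))
  have hc' : 0 < 1 - c := by linarith
  rw [div_le_iff₀ hc'] at hq
  have hlim : Tendsto (fun m : ℕ => (1 - 2 * q * (q + 1) / m : ℝ)) atTop (𝓝 (1 - 0)) :=
    tendsto_const_nhds.sub (tendsto_const_div_atTop_nhds_zero_nat _)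
  -- Dividing `c` by the ratio `2 * c / (1 + c)` gives the target `(1 + c) / 2`.
  have hev := hlim.eventually (lt_mem_nhds (show 2 * c / (1 + c) < 1 - 0 by
    rw [div_lt_iff₀ (by linarith)]; linarith))
  obtain ⟨m₁, hm₁⟩ := eventually_atTop.1 hev
  refine ⟨max m₁ (2 * q + 2), fun m w hm hw => ?_⟩
  have hlow := hm₁ m (le_trans (le_max_left _ _) hm)
  have hm2 : 2 * q + 2 ≤ m := le_trans (le_max_right _ _) hm
  set J := Ico (m / 2 + 1 - q) (m / 2 + 1 + q) with hJ
  have hJsub : J ⊆ range (m + 1) := fun i hi => by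
    have := mem_Ico.1 hi
    rw [mem_range]; omega
  have hterm : ∀ i ∈ J, min 1 ((w : ℝ) / (m.choose i : ℝ)) ≤ (1 + c) / 2 := by
    intro i hi
    have hi' := mem_Ico.1 hi
    refine (min_le_right _ _).trans ?_
    have h1 := one_sub_mul_le_choose (n := m) (i := i) (j := q) (by omega) (by omega) (by omega)
    have hC : (0 : ℝ) < m.choose (m / 2) := by exact_mod_cast Nat.choose_pos (by omega)
    have h2 : 2 * c / (1 + c) * (m.choose (m / 2) : ℝ) ≤ m.choose i :=
      le_trans (by gcongr) h1
    have hCi : (0 : ℝ) < m.choose i := by exact_mod_cast Nat.choose_pos (by omega)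
    rw [div_mul_eq_mul_div, div_le_iff₀ (by linarith)] at h2
    rw [div_le_div_iff₀ hCi (by norm_num)]
    nlinarith
  have hcard : #J = 2 * q := by rw [hJ, Nat.card_Ico]; omega
  unfold capSum
  rw [← sum_sdiff hJsub]
  have s1 : ∑ i ∈ range (m + 1) \ J, min 1 ((w : ℝ) / (m.choose i : ℝ)) ≤ m + 1 - 2 * q := by
    refine (sum_le_card_nsmul _ _ 1 fun i _ => min_le_left _ _).trans ?_
    rw [card_sdiff_of_subset hJsub, card_range, hcard, nsmul_eq_mul, mul_one,
      Nat.cast_sub (by omega)]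
    push_cast
    exact le_rfl
  have s2 := sum_le_card_nsmul _ _ _ hterm
  rw [hcard, nsmul_eq_mul] at s2
  push_cast at s2
  linarith

theorem exists_capSum_le_mStar {c : ℝ} (hc0 : 0 < c) (hc : c < 1) :
    ∃ sc : ℕ, ∀ s : ℕ, sc ≤ s → 2 ≤ s ∧
      ((s : ℝ) ≤ c * ((mStar s).choose ((mStar s + 1) / 2) : ℝ) →
        ∀ N, capSum (s - 1) N ≤ mStar s) := by
  obtain ⟨m₀, hm₀⟩ := exists_capSum_middle_le hc0 hc
  refine ⟨2 ^ (max m₀ 8) + 1, fun s hs => ?_⟩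
  have hm : max m₀ 8 ≤ mStar s := le_mStar hs
  have hpos := Nat.one_le_two_pow (n := max m₀ 8)
  refine ⟨by omega, fun h => ?_⟩
  rw [choose_add_one_div_two] at h
  refine capSum_le_of_middle (Or.inl (le_trans (le_max_right _ _) hm))
    ((Nat.sub_le _ _).trans (le_choose_mStar s)) le_rfl
    (hm₀ _ _ (le_trans (le_max_left _ _) hm) (le_trans ?_ h))
  exact_mod_cast Nat.sub_le _ _

/-- Without a gap below the central coefficient only the trivial count of `mStar s + 1` levels is
available; `2 ^ 8 < s` ensures `8 ≤ mStar s`, as monotonicity requires. -/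
theorem exists_capSum_le_mStar_add_one :
    ∃ s₀ : ℕ, ∀ s : ℕ, s₀ ≤ s → 2 ≤ s ∧ ∀ N, capSum (s - 1) N ≤ mStar s + 1 := by
  refine ⟨2 ^ 8 + 1, fun s hs => ⟨by omega, ?_⟩⟩
  exact capSum_le_of_middle (Or.inl (le_mStar hs))
    ((Nat.sub_le _ _).trans (le_choose_mStar s)) (by linarith) (capSum_le_succ _ _)

/-- For `N ≥ d`, a bound for the sum of the reciprocals of the binomial coefficients of `N` over
`1, …, N - 3`. -/
noncomputable def recipBound (d : ℕ) : ℝ :=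
  1 / d + 8 / ((d - 1) * (d - 2))

/-- The bound for the contribution of an outermost level with `w + 1` elements. -/
noncomputable def endBound (w d : ℕ) : ℝ :=
  if w = 0 then 0 else 1 + w * recipBound d

theorem recipBound_nonneg {d : ℕ} (hd : 3 ≤ d) : 0 ≤ recipBound d := by
  have : (3 : ℝ) ≤ d := by exact_mod_cast hd
  have h1 : (0 : ℝ) < d - 1 := by linarith
  have h2 : (0 : ℝ) < d - 2 := by linarith
  unfold recipBound
  positivity

theorem endBound_nonneg (w : ℕ) {d : ℕ} (hd : 3 ≤ d) : 0 ≤ endBound w d := by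
  unfold endBound
  have := recipBound_nonneg hd
  split_ifs <;> positivity

/-- The terms `i = 1` and `i = 2` are kept and fewer than `N` others are at most the reciprocal of
`N.choose 3`; the `8` in `recipBound` is `2 + 6`. Stopping at `N - 3` leaves a single term of order
`1 / N`. -/
theorem sum_Ico_inv_choose_le {N d : ℕ} (hd : 3 ≤ d) (hN : d ≤ N) :
    ∑ i ∈ Ico 1 (N - 2), (N.choose i : ℝ)⁻¹ ≤ recipBound d := by
  have hdR : (3 : ℝ) ≤ d := by exact_mod_cast hd
  have hNR : (d : ℝ) ≤ N := by exact_mod_cast hN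
  have h1 : (0 : ℝ) < d - 1 := by linarith
  have h2 : (0 : ℝ) < d - 2 := by linarith
  have c2 : (N.choose 2 : ℝ) = N * (N - 1) / 2 := Nat.cast_choose_two ℝ N
  have c3 : (N.choose 3 : ℝ) = N * (N - 1) * (N - 2) / 6 := by
    have := Nat.choose_succ_right_eq N 2
    have h : (N.choose 3 : ℝ) * 3 = N.choose 2 * (N - 2) := by
      have hs : ((N - 2 : ℕ) : ℝ) = N - 2 := by
        rw [Nat.cast_sub (by omega)]
        norm_num
      rw [← hs]
      exact_mod_cast this
    rw [c2] at h
    linarith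
  have hterm : ∀ i ∈ Ico 1 (N - 2), (N.choose i : ℝ)⁻¹ ≤
      (if i = 1 then (N : ℝ)⁻¹ else 0) + (if i = 2 then (N.choose 2 : ℝ)⁻¹ else 0) +
        (N.choose 3 : ℝ)⁻¹ := by
    intro i hi
    have hi' := mem_Ico.1 hi
    have hp : (0 : ℝ) ≤ (N.choose 3 : ℝ)⁻¹ := by positivity
    rcases (by omega : i = 1 ∨ i = 2 ∨ 3 ≤ i) with rfl | rfl | h3
    · simp
    · simp
    · rw [if_neg (by omega), if_neg (by omega), zero_add, zero_add]
      have hpos : 0 < N.choose 3 := Nat.choose_pos (by omega)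
      have := choose_le_choose_of_add_le (N := N) h3 (by omega)
      gcongr
  refine (sum_le_sum hterm).trans ?_
  rw [sum_add_distrib, sum_add_distrib, sum_ite_eq', sum_ite_eq', sum_const, nsmul_eq_mul,
    Nat.card_Ico, c2, c3]
  have k1 : (if 1 ∈ Ico 1 (N - 2) then (N : ℝ)⁻¹ else 0) ≤ 1 / d := by
    split_ifs
    · rw [← one_div]
      exact one_div_le_one_div_of_le (by linarith) hNR
    · positivity
  have k2 : (if 2 ∈ Ico 1 (N - 2) then ((N : ℝ) * (N - 1) / 2)⁻¹ else 0) ≤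
      2 / ((d - 1) * (d - 2)) := by
    split_ifs
    · rw [inv_div]
      have : (d - 1 : ℝ) * (d - 2) ≤ N * (N - 1) := by nlinarith
      gcongr
    · positivity
  have k3 : ((N - 2 - 1 : ℕ) : ℝ) * ((N : ℝ) * (N - 1) * (N - 2) / 6)⁻¹ ≤
      6 / ((d - 1) * (d - 2)) := by
    have hN0 : (0 : ℝ) < N := by linarith
    have hN1 : (0 : ℝ) < N - 1 := by linarith
    have hN2 : (0 : ℝ) < N - 2 := by linarith
    calc ((N - 2 - 1 : ℕ) : ℝ) * ((N : ℝ) * (N - 1) * (N - 2) / 6)⁻¹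
        ≤ N * ((N : ℝ) * (N - 1) * (N - 2) / 6)⁻¹ := by
          gcongr
          omega
      _ = 6 / ((N - 1) * (N - 2)) := by
          field_simp
      _ ≤ 6 / ((d - 1) * (d - 2)) := by
          gcongr
  have : (8 : ℝ) / ((d - 1) * (d - 2)) = 2 / ((d - 1) * (d - 2)) + 6 / ((d - 1) * (d - 2)) := by
    rw [← add_div]; norm_num
  unfold recipBound
  linarith

theorem sum_range_min_le {w N d : ℕ} (hd : 3 ≤ d) (hN : d ≤ N) :
    ∑ i ∈ range (N - 2), min 1 ((w : ℝ) / (N.choose i : ℝ)) ≤ endBound w d := by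
  unfold endBound
  split_ifs with hw
  · simp [hw]
  rw [range_eq_Ico, sum_eq_sum_Ico_succ_bot (by omega)]
  refine add_le_add (min_le_left _ _) ?_
  refine le_trans ?_ (mul_le_mul_of_nonneg_left (sum_Ico_inv_choose_le hd hN) (by positivity))
  rw [mul_sum]
  exact sum_le_sum fun i _ => (min_le_right _ _).trans (div_eq_mul_inv _ _).le

theorem sum_Icc_min_le {w N d : ℕ} (hd : 3 ≤ d) (hN : d ≤ N) :
    ∑ i ∈ Icc 3 N, min 1 ((w : ℝ) / (N.choose i : ℝ)) ≤ endBound w d := by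
  refine le_trans (le_of_eq ?_) (sum_range_min_le hd hN)
  refine sum_nbij' (fun i => N - i) (fun i => N - i) ?_ ?_ ?_ ?_ ?_
  all_goals intro i hi; simp only [mem_Icc, mem_range] at hi ⊢
  · omega
  · omega
  · omega
  · omega
  · rw [Nat.choose_symm hi.2]

variable {n : ℕ}

/-- Members have size at least `3`, so the three lowest levels of `[∅, X]` are empty and large
weights occur only near `X`. As `X` is itself a member, the interval has dimension at least `d`. -/
theorem lubell_bottom_le {F : Finset (Finset (Fin n))} {d w : ℕ} (hd : 3 ≤ d)
    (hF : ∀ X ∈ F, d ≤ #X) {X : Finset (Fin n)} (hX : X ∈ F)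
    (h : ¬ HasAntichain (F : Set (Finset (Fin n))) ∅ X (w + 1)) :
    lubell F ∅ X ≤ endBound w d := by
  refine (lubell_le_sum_min (empty_subset _) h (Icc 3 #X) fun Y hY _ hYX => ?_).trans ?_
  · rw [mem_Icc, card_empty, Nat.sub_zero]
    exact ⟨hd.trans (hF Y hY), card_le_card hYX⟩
  · rw [card_empty, Nat.sub_zero]
    exact sum_Icc_min_le hd (hF X hX)

theorem lubell_top_le {F : Finset (Finset (Fin n))} {d w : ℕ} (hd : 3 ≤ d)
    (hF : ∀ X ∈ F, #X + d ≤ n) {A : Finset (Fin n)}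
    (h : ¬ HasAntichain (F : Set (Finset (Fin n))) A univ (w + 1)) :
    lubell F A univ ≤ endBound w d := by
  by_cases hA : #A + d ≤ n
  · refine (lubell_le_sum_min (subset_univ _) h (range (n - #A - 2)) fun Y hY hAY _ => ?_).trans ?_
    · have := hF Y hY
      have := card_le_card hAY
      rw [mem_range]
      omega
    · rw [card_univ, Fintype.card_fin]
      exact sum_range_min_le hd (by omega)
  -- Here `A` is larger than every member, so the interval contains none.
  · refine (lubell_le_sum_min (subset_univ _) h ∅ fun Y hY hAY _ => ?_).trans ?_
    · have := hF Y hY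
      have := card_le_card hAY
      omega
    · rw [sum_empty]
      exact endBound_nonneg w hd

theorem lubell_le_capSum {F : Finset (Finset (Fin n))} {w : ℕ} {A X : Finset (Fin n)} (hAX : A ⊆ X)
    (h : ¬ HasAntichain (F : Set (Finset (Fin n))) A X (w + 1)) :
    lubell F A X ≤ capSum w (#X - #A) := by
  refine lubell_le_sum_min hAX h (range (#X - #A + 1)) fun Y _ _ hYX => ?_
  have := card_le_card hYX
  rw [mem_range]
  omega

theorem isChain_levels {r t : ℕ} {ss : List ℕ} (hss : ss ≠ []) (h2 : ∀ s ∈ ss, 2 ≤ s) :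
    (r :: (ss ++ [t])).IsChain (fun a b => 2 ≤ a ∨ 2 ≤ b) := by
  rw [List.isChain_cons]
  refine ⟨fun y hy => ?_, ?_⟩
  · cases ss with
    | nil => exact absurd rfl hss
    | cons s ss =>
      obtain rfl : s = y := by simpa using hy
      exact Or.inr (h2 _ List.mem_cons_self)
  · clear hss
    induction ss with
    | nil => simp
    | cons s ss ih =>
      rw [List.cons_append, List.isChain_cons]
      exact ⟨fun y _ => Or.inl (h2 s List.mem_cons_self),
        ih fun a ha => h2 a (List.mem_cons_of_mem _ ha)⟩

/-- The Lubell mass of a family without complete multilevel posets that avoids the levels close to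
the bottom and to the top. -/
theorem lubell_le_of_inducedFree {F : Finset (Finset (Fin n))} {r t d : ℕ} {ss : List ℕ}
    {M : ℕ → ℝ} (hr : 1 ≤ r) (ht : 1 ≤ t) (hss : ss ≠ []) (h2 : ∀ s ∈ ss, 2 ≤ s)
    (hM0 : ∀ s, 0 ≤ M s) (hM : ∀ s ∈ ss, ∀ N, capSum (s - 1) N ≤ M s) (hd : 3 ≤ d)
    (hF : ∀ X ∈ F, d ≤ #X ∧ #X + d ≤ n)
    (hfree : InducedFree (KPoset r ss t) (F : Set (Finset (Fin n)))) :
    lubell F ∅ univ ≤ endBound (r - 1) d + ((ss.map M).sum + endBound (t - 1) d) := by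
  refine lubell_le_add_of_not_hasStack (s := r) (ℓ := ss ++ [t]) (endBound_nonneg _ hd)
    (add_nonneg (List.sum_nonneg (by simpa using fun a _ => hM0 a)) (endBound_nonneg _ hd))
    (fun X hX _ h => lubell_bottom_le hd (fun Y hY => (hF Y hY).1) hX
      (by rwa [Nat.sub_add_cancel hr]))
    (fun X _ h => lubell_le_of_not_hasStack hM0 (endBound_nonneg _ hd)
      (fun A hA => lubell_top_le hd (fun Y hY => (hF Y hY).2) (by rwa [Nat.sub_add_cancel ht]))
      ss (fun s hs A X hAX h => ?_) X h) fun h => ?_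
  · have := h2 s hs
    exact (lubell_le_capSum hAX (by rwa [Nat.sub_add_cancel (by omega)])).trans (hM s hs _)
  · refine not_inducedFree_of_hasStack (isChain_levels hss h2) (fun s hs => ?_) h hfree
    simp only [List.mem_cons, List.mem_append, List.not_mem_nil, or_false] at hs
    rcases hs with rfl | hs | rfl
    · exact hr
    · exact (h2 s hs).trans' (by norm_num)
    · exact ht

end Bounds

/-! ### The asymptotic upper bound. -/

section Upper
open Finset

theorem card_filter_card_lt_le (n d : ℕ) :
    #{X : Finset (Fin n) | #X < d} ≤ ∑ i ∈ range d, n.choose i := by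
  rw [card_eq_sum_card_fiberwise (f := fun X => #X) (t := range d)
    (fun X hX => by simpa using hX)]
  refine sum_le_sum fun i _ => ?_
  have := card_powersetCard i (univ : Finset (Fin n))
  rw [card_univ, Fintype.card_fin] at this
  rw [← this]
  refine card_le_card fun X hX => ?_
  rw [mem_powersetCard]
  exact ⟨subset_univ _, (mem_filter.1 hX).2⟩

theorem card_filter_lt_card_add_le (n d : ℕ) :
    #{X : Finset (Fin n) | n < #X + d} ≤ ∑ i ∈ range d, n.choose i := by
  refine le_trans ?_ (card_filter_card_lt_le n d)
  refine card_le_card_of_injOn (fun X => Xᶜ) (fun X hX => ?_) compl_injective.injOn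
  have h1 : n < #X + d := by simpa using hX
  have h2 := card_le_univ X
  rw [Fintype.card_fin] at h2
  have : #Xᶜ < d := by
    rw [card_compl, Fintype.card_fin]
    omega
  simpa using this

theorem card_le_of_inducedFree {n K r t : ℕ} {F : Finset (Finset (Fin n))} {ss : List ℕ}
    {M : ℕ → ℝ} (hr : 1 ≤ r) (ht : 1 ≤ t) (hss : ss ≠ []) (h2 : ∀ s ∈ ss, 2 ≤ s)
    (hM0 : ∀ s, 0 ≤ M s) (hM : ∀ s ∈ ss, ∀ N, capSum (s - 1) N ≤ M s)
    (hK : 2 ≤ K) (hn : K ≤ n) (hd : 3 ≤ n / 2 - 2 * (n / K))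
    (hfree : InducedFree (KPoset r ss t) (F : Set (Finset (Fin n)))) :
    (#F : ℝ) ≤ (endBound (r - 1) (n / 2 - 2 * (n / K)) + ((ss.map M).sum +
      endBound (t - 1) (n / 2 - 2 * (n / K))) + 2 * n * (1 - 1 / K : ℝ) ^ (n / K)) *
        (n.choose (n / 2) : ℝ) := by
  set d := n / 2 - 2 * (n / K) with hd_def
  set G : Finset (Finset (Fin n)) := {X ∈ F | d ≤ #X ∧ #X + d ≤ n} with hG
  have hGfree : InducedFree (KPoset r ss t) (G : Set (Finset (Fin n))) := fun ⟨i, hi⟩ =>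
    hfree ⟨i, fun p => mem_coe.2 (filter_subset _ _ (mem_coe.1 (hi p)))⟩
  have h1 := lubell_le_of_inducedFree hr ht hss h2 hM0 hM hd
    (fun X hX => (mem_filter.1 hX).2) hGfree
  have h3 := card_le_lubell_mul G (empty_subset univ)
  rw [filter_true_of_mem fun X _ => ⟨empty_subset _, subset_univ _⟩, card_univ, card_empty,
    Nat.sub_zero, Fintype.card_fin] at h3
  have hsub : F ⊆ G ∪ (univ.filter (fun X => #X < d) ∪ univ.filter (fun X => n < #X + d)) := by
    intro X hX
    simp only [hG, mem_union, mem_filter, mem_univ, true_and, hX]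
    omega
  have h4 : #F ≤ #G + (∑ i ∈ range d, n.choose i + ∑ i ∈ range d, n.choose i) :=
    (card_le_card hsub).trans ((card_union_le _ _).trans (add_le_add_right
      ((card_union_le _ _).trans (add_le_add (card_filter_card_lt_le n d)
        (card_filter_lt_card_add_le n d))) _))
  have h5 : (∑ i ∈ range d, (n.choose i : ℝ)) ≤
      n * ((1 - 1 / K : ℝ) ^ (n / K) * (n.choose (n / 2) : ℝ)) := by
    refine (sum_le_card_nsmul _ _ _ fun i hi =>
      choose_le_pow_mul hK hn (mem_range.1 hi)).trans ?_
    have hKR : (2 : ℝ) ≤ K := by exact_mod_cast hK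
    have hq : (0 : ℝ) ≤ 1 - 1 / K := by
      rw [sub_nonneg, div_le_one (by linarith)]; linarith
    rw [card_range, nsmul_eq_mul]
    gcongr
    omega
  have h4' : (#F : ℝ) ≤ #G + (∑ i ∈ range d, (n.choose i : ℝ) + ∑ i ∈ range d, (n.choose i : ℝ)) := by
    exact_mod_cast h4
  have h6 := mul_le_mul_of_nonneg_right h1 (Nat.cast_nonneg (α := ℝ) (n.choose (n / 2)))
  linarith

/-- The rounding in `n / 2` loses at most `1 / 2`, which `K ≤ n` absorbs into one more `n / K`;
hence `3 / K` in place of `2 / K`. -/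
theorem cutoff_lower {n K : ℕ} (hK : 2 ≤ K) (hn : K ≤ n) :
    (1 / 2 - 3 / K : ℝ) * n ≤ (n / 2 - 2 * (n / K) : ℕ) := by
  have h1 : n ≤ 2 * (n / 2 - 2 * (n / K)) + 4 * (n / K) + 1 := by omega
  have h2 : (n : ℝ) ≤ 2 * (n / 2 - 2 * (n / K) : ℕ) + 4 * (n / K : ℕ) + 1 := by exact_mod_cast h1
  have h3 : ((n / K : ℕ) : ℝ) ≤ n / K := Nat.cast_div_le
  have hK0 : (0 : ℝ) < K := by exact_mod_cast (by omega : 0 < K)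
  have h4 : (1 : ℝ) ≤ n / K := by
    rw [le_div_iff₀ hK0, one_mul]
    exact_mod_cast hn
  have h5 : (1 / 2 - 3 / K : ℝ) * n = n / 2 - 3 * (n / K) := by ring
  linarith

theorem mul_recipBound_le {θ : ℝ} (hθ : 0 < θ) {n d : ℕ} (hn : 4 ≤ θ * n) (hd : θ * n ≤ d) :
    n * recipBound d ≤ 1 / θ + 32 / θ ^ 2 / n := by
  have hn0 : (0 : ℝ) < n := by
    by_contra! h
    nlinarith
  unfold recipBound
  have e1 : (1 : ℝ) / d ≤ 1 / (θ * n) := one_div_le_one_div_of_le (by linarith) hd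
  have e2 : (8 : ℝ) / ((d - 1) * (d - 2)) ≤ 8 / ((θ * n / 2) * (θ * n / 2)) := by
    have : (0 : ℝ) < θ * n / 2 := by linarith
    have h1 : θ * n / 2 ≤ (d : ℝ) - 1 := by linarith
    have h2 : θ * n / 2 ≤ (d : ℝ) - 2 := by linarith
    exact div_le_div_of_nonneg_left (by norm_num) (by positivity)
      (mul_le_mul h1 h2 this.le (this.le.trans h1))
  calc (n : ℝ) * (1 / d + 8 / ((d - 1) * (d - 2)))
      ≤ n * (1 / (θ * n) + 8 / ((θ * n / 2) * (θ * n / 2))) := by gcongr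
    _ = 1 / θ + 32 / θ ^ 2 / n := by
      field_simp
      ring

/-- The cutoff is at least `θ * n` with `θ = 1 / 2 - 3 / K`, and `1 / θ` tends to `2` as `K` grows.
This produces the factor `2` in `2 * (r + t - 2) / n`. -/
theorem exists_eventually_mul_recipBound_le {η : ℝ} (hη : 0 < η) :
    ∃ K : ℕ, 2 ≤ K ∧ ∀ᶠ n : ℕ in atTop, 3 ≤ n / 2 - 2 * (n / K) ∧
      n * recipBound (n / 2 - 2 * (n / K)) ≤ 2 + η := by
  have hlim : Tendsto (fun K : ℕ => 1 / (1 / 2 - 3 / K : ℝ)) atTop (𝓝 (1 / (1 / 2 - 0))) :=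
    tendsto_const_nhds.div (tendsto_const_nhds.sub (tendsto_const_div_atTop_nhds_zero_nat _))
      (by norm_num)
  obtain ⟨K, hK, hK7⟩ := ((hlim.eventually (gt_mem_nhds
    (show 1 / (1 / 2 - 0) < 2 + η by norm_num; exact hη))).and (eventually_ge_atTop 7)).exists
  refine ⟨K, by omega, ?_⟩
  have hKR : (7 : ℝ) ≤ K := by exact_mod_cast hK7
  set θ : ℝ := 1 / 2 - 3 / K with hθ
  have hθ0 : 0 < θ := by
    rw [hθ, sub_pos, div_lt_div_iff₀ (by linarith) (by norm_num)]
    linarith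
  have hlim2 : Tendsto (fun n : ℕ => 1 / θ + 32 / θ ^ 2 / n) atTop (𝓝 (1 / θ + 0)) :=
    tendsto_const_nhds.add (tendsto_const_div_atTop_nhds_zero_nat _)
  have hlim3 : Tendsto (fun n : ℕ => θ * (n : ℝ)) atTop atTop :=
    tendsto_natCast_atTop_atTop.const_mul_atTop hθ0
  filter_upwards [hlim2.eventually (gt_mem_nhds (show 1 / θ + 0 < 2 + η by rwa [add_zero])),
    hlim3.eventually_ge_atTop 4, eventually_ge_atTop K] with n h1 h2 h3
  have hc := cutoff_lower (by omega) h3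
  rw [← hθ] at hc
  refine ⟨?_, (mul_recipBound_le hθ0 h2 hc).trans h1.le⟩
  have : (3 : ℝ) ≤ (n / 2 - 2 * (n / K) : ℕ) := by linarith
  exact_mod_cast this

/-- One factor `n` counts the discarded levels; the other makes their contribution `o(1 / n)`. -/
theorem tendsto_sq_mul_pow_div {K : ℕ} (hK : 2 ≤ K) :
    Tendsto (fun n : ℕ => (n : ℝ) ^ 2 * (1 - 1 / K : ℝ) ^ (n / K)) atTop (𝓝 0) := by
  have hKR : (2 : ℝ) ≤ K := by exact_mod_cast hK
  have hq0 : (0 : ℝ) < 1 - 1 / K := by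
    rw [sub_pos, div_lt_one (by linarith)]; linarith
  have hq1 : (1 - 1 / K : ℝ) < 1 := by
    have : (0 : ℝ) < 1 / K := by positivity
    linarith
  set q : ℝ := 1 - 1 / K with hq
  have h1 : Tendsto (fun x : ℕ => (x : ℝ) ^ 2 * q ^ x) atTop (𝓝 0) :=
    tendsto_pow_const_mul_const_pow_of_lt_one 2 hq0.le hq1
  have h2 : Tendsto (fun x : ℕ => (K : ℝ) ^ 2 / q * (((x + 1 : ℕ) : ℝ) ^ 2 * q ^ (x + 1))) atTop
      (𝓝 ((K : ℝ) ^ 2 / q * 0)) := (h1.comp (tendsto_add_atTop_nat 1)).const_mul _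
  rw [mul_zero] at h2
  have h3 := h2.comp (Nat.tendsto_div_const_atTop (show K ≠ 0 by omega))
  refine squeeze_zero (fun n => by positivity) (fun n => ?_) h3
  have hn : (n : ℝ) ≤ K * ((n / K : ℕ) + 1 : ℕ) := by
    exact_mod_cast (Nat.lt_mul_div_succ n (by omega : 0 < K)).le
  calc (n : ℝ) ^ 2 * q ^ (n / K) ≤ (K * ((n / K : ℕ) + 1 : ℕ)) ^ 2 * q ^ (n / K) := by gcongr
    _ = _ := by
      simp only [Function.comp_apply, pow_succ q]
      field_simp

theorem endBound_eq (w d : ℕ) :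
    endBound w d = (if w = 0 then 0 else 1) + w * recipBound d := by
  unfold endBound
  split_ifs with h <;> simp [h]

theorem fPair_eq {r t : ℕ} (hr : 1 ≤ r) (ht : 1 ≤ t) :
    (fPair r t : ℝ) = (if r - 1 = 0 then 0 else 1) + (if t - 1 = 0 then 0 else 1) := by
  unfold fPair
  have h1 : r - 1 = 0 ↔ r = 1 := by omega
  have h2 : t - 1 = 0 ↔ t = 1 := by omega
  simp only [h1, h2]
  by_cases h3 : r = 1 <;> by_cases h4 : t = 1 <;> norm_num [h3, h4]

theorem nonempty_kPoset {r t : ℕ} {ss : List ℕ} (hr : 1 ≤ r) : Nonempty (KPoset r ss t) :=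
  ⟨⟨⟨0, by simp⟩, ⟨0, hr⟩⟩⟩

theorem eventually_laStar_le {r t : ℕ} {ss : List ℕ} {M : ℕ → ℝ} (hr : 1 ≤ r) (ht : 1 ≤ t)
    (hss : ss ≠ []) (h2 : ∀ s ∈ ss, 2 ≤ s) (hM0 : ∀ s, 0 ≤ M s)
    (hM : ∀ s ∈ ss, ∀ N, capSum (s - 1) N ≤ M s) {η : ℝ} (hη : 0 < η) :
    ∀ᶠ n : ℕ in atTop, (LaStar (KPoset r ss t) n : ℝ) ≤
      ((ss.map M).sum + fPair r t + 2 * ((r : ℝ) + t - 2) / n + η / n) *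
        (n.choose (n / 2) : ℝ) := by
  have hrt : (0 : ℝ) < (r : ℝ) + t := by
    have : (1 : ℝ) ≤ r := by exact_mod_cast hr
    positivity
  -- Half of `η` is spent on the two end levels, half on the discarded tails.
  obtain ⟨K, hK, hev⟩ := exists_eventually_mul_recipBound_le
    (show 0 < η / (2 * ((r : ℝ) + t)) by positivity)
  filter_upwards [hev, (tendsto_sq_mul_pow_div hK).eventually (gt_mem_nhds
    (show 0 < η / 4 by positivity)), eventually_ge_atTop K] with n h1 h3 hn
  have := nonempty_kPoset (t := t) (ss := ss) hr
  obtain ⟨F, hF, hcard⟩ := (laStar_isGreatest (KPoset r ss t) n).1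
  rw [← hcard]
  refine (card_le_of_inducedFree hr ht hss h2 hM0 hM hK hn h1.1 hF).trans ?_
  have hn0 : (0 : ℝ) < n := by exact_mod_cast (by omega : 0 < n)
  refine mul_le_mul_of_nonneg_right ?_ (Nat.cast_nonneg _)
  rw [endBound_eq, endBound_eq, fPair_eq hr ht, Nat.cast_sub hr, Nat.cast_sub ht]
  set ρ := recipBound (n / 2 - 2 * (n / K))
  set τ := (1 - 1 / K : ℝ) ^ (n / K)
  have e1 : ρ ≤ (2 + η / (2 * ((r : ℝ) + t))) / n := by
    rw [le_div_iff₀ hn0, mul_comm]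
    exact h1.2
  have e2 : 2 * (n : ℝ) * τ ≤ η / 2 / n := by
    rw [le_div_iff₀ hn0]
    nlinarith
  have e3 : ((r : ℝ) - 1 + (t - 1)) * ρ ≤ 2 * ((r : ℝ) + t - 2) / n + η / 2 / n := by
    have hnn : (0 : ℝ) ≤ (r : ℝ) - 1 + (t - 1) := by
      have h1 : (1 : ℝ) ≤ r := by exact_mod_cast hr
      have h2 : (1 : ℝ) ≤ t := by exact_mod_cast ht
      linarith
    refine (mul_le_mul_of_nonneg_left e1 hnn).trans ?_
    rw [← add_div, mul_div_assoc', div_le_div_iff_of_pos_right hn0, mul_add]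
    have : ((r : ℝ) - 1 + (t - 1)) * (η / (2 * ((r : ℝ) + t))) ≤ η / 2 := by
      rw [mul_div_assoc', div_le_div_iff₀ (by positivity) (by norm_num)]
      nlinarith
    linarith
  have e4 : η / n = η / 2 / n + η / 2 / n := by ring
  rw [e4]
  push_cast
  linarith

/-- The positive part of the rescaled excess is a single error term that works for every `η` at
once. -/
theorem exists_tendsto_zero_of_forall_pos {u c : ℕ → ℝ} {x y : ℝ} (hc : ∀ n, 0 < c n)
    (h : ∀ η : ℝ, 0 < η → ∀ᶠ n : ℕ in atTop, u n ≤ (x + y / n + η / n) * c n) :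
    ∃ ε : ℕ → ℝ, Tendsto ε atTop (𝓝 0) ∧
      ∀ᶠ n : ℕ in atTop, u n ≤ (x + y / n + ε n / n) * c n := by
  refine ⟨fun n => max 0 (n * (u n / c n - x - y / n)), ?_, ?_⟩
  · rw [Metric.tendsto_atTop']
    intro δ hδ
    obtain ⟨N, hN⟩ := eventually_atTop.1 (h (δ / 2) (by positivity))
    refine ⟨N, fun n hn => ?_⟩
    have h1 := hN n hn.le
    have hn0 : (0 : ℝ) < n := by exact_mod_cast (by omega : 0 < n)
    rw [← div_le_iff₀ (hc n)] at h1
    rw [Real.dist_eq, sub_zero, abs_of_nonneg (le_max_left _ _)]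
    refine (max_le (by positivity) ?_).trans_lt (half_lt_self hδ)
    rw [← le_div_iff₀' hn0]
    linarith
  · filter_upwards [eventually_gt_atTop 0] with n hn
    have hn0 : (0 : ℝ) < n := by exact_mod_cast hn
    rw [← div_le_iff₀ (hc n)]
    have := le_max_right 0 (n * (u n / c n - x - y / n))
    rw [← le_div_iff₀' hn0] at this
    linarith

end Upper

/-! ### Free families: consecutive levels with sparse additions. -/

section Lower
open Finset

/-- Sperner's theorem in an interval: a chain meets an antichain at most once, so the antichain has
mass at most one. -/
theorem HasAntichain.add_mStar_le {α : Type*} [DecidableEq α] {F : Set (Finset α)} {A X : Finset α}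
    {s : ℕ} (hAX : A ⊆ X) (h : HasAntichain F A X s) : #A + mStar s ≤ #X := by
  obtain ⟨S, hS, hanti, hmem⟩ := h
  have hl : lubell S A X ≤ 1 := by
    refine lubell_le_of_forall_mem zero_le_one X hAX fun Y hY hAY _ => ?_
    unfold lubell
    have : {Z ∈ S | A ⊆ Z ∧ Z ⊆ Y} = {Y} := by
      ext Z
      simp only [mem_filter, mem_singleton]
      constructor
      · rintro ⟨hZ, -, hZY⟩
        exact hanti.eq hZ hY hZY
      · rintro rfl
        exact ⟨hY, hAY, subset_rfl⟩
    rw [this, sum_singleton, Nat.choose_self, Nat.cast_one, inv_one]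
  have hc := card_le_lubell_mul S hAX
  rw [filter_true_of_mem fun Y hY => (hmem Y hY).2, hS] at hc
  have hsC : s ≤ (#X - #A).choose ((#X - #A) / 2) := by
    have h1 := mul_le_mul_of_nonneg_right hl
      (Nat.cast_nonneg (α := ℝ) ((#X - #A).choose ((#X - #A) / 2)))
    rw [one_mul] at h1
    exact_mod_cast hc.trans h1
  have h2 : mStar s ≤ #X - #A := (mStar_isLeast s).2 (by
    rw [Set.mem_ofPred_eq, choose_add_one_div_two]
    exact hsC)
  have := card_le_card hAX
  omega

theorem HasStack.exists_top {α : Type*} [DecidableEq α] {F : Set (Finset α)} {t : ℕ} :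
    ∀ (ss : List ℕ) (A : Finset α), HasStack F (ss ++ [t]) A →
      ∃ V X, #A + (ss.map mStar).sum ≤ #V ∧ HasAntichain F V X t
  | [], A, ⟨X, _, h, _⟩ => ⟨A, X, by simp, h⟩
  | s :: ss, A, ⟨X, hAX, h, hX⟩ => by
    obtain ⟨V, Y, h1, h2⟩ := HasStack.exists_top ss X hX
    have := h.add_mStar_le hAX
    exact ⟨V, Y, by rw [List.map_cons, List.sum_cons]; omega, h2⟩

variable {n : ℕ}

theorem inducedFree_of_ends {F : Set (Finset (Fin n))} {r t a b y : ℕ} {ss : List ℕ}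
    (hlo : ∀ X, HasAntichain F ∅ X r → a ≤ #X) (hhi : ∀ A, HasAntichain F A univ t → #A + y ≤ b)
    (hab : b < a + y + (ss.map mStar).sum) : InducedFree (KPoset r ss t) F := by
  rintro ⟨i, hi⟩
  obtain ⟨X, -, h1, h2⟩ := hasStack_of_orderEmbedding i hi
  obtain ⟨V, Y, h3, h4⟩ := h2.exists_top
  have := hlo X h1
  have := hhi V (h4.mono (subset_univ _))
  omega

/-- For `r ≥ 2` the antichain cannot contain `X` itself. If `#X ≤ a`, its members therefore all lie
in `G`, and `X` would have size `a` and contain `r` sets of `G`. -/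
theorem le_card_of_hasAntichain_bottom {F : Set (Finset (Fin n))} {G : Finset (Finset (Fin n))}
    {a r : ℕ} (hr : 1 ≤ r) (hF : ∀ Y ∈ F, a ≤ #Y ∨ #Y + 1 = a ∧ Y ∈ G)
    (hG : ∀ Y : Finset (Fin n), #Y = a → #{X ∈ G | X ⊆ Y} ≤ r - 1) (hG0 : r = 1 → G = ∅)
    {X : Finset (Fin n)} (h : HasAntichain F ∅ X r) : a + (if r = 1 then 0 else 1) ≤ #X := by
  obtain ⟨S, hS, hanti, hmem⟩ := h
  split_ifs with hr1
  · obtain ⟨Y, hY⟩ := card_pos.1 (show 0 < #S by omega)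
    have := card_le_card (hmem Y hY).2.2
    rcases hF Y (hmem Y hY).1 with h | ⟨-, h⟩
    · omega
    · simp [hG0 hr1] at h
  · by_contra! hlt
    have hall : ∀ Y ∈ S, Y ≠ X := by
      rintro Y hY rfl
      obtain ⟨Z, hZ, hne⟩ := exists_mem_ne (show 1 < #S by omega) Y
      exact hanti hZ hY hne (hmem Z hZ).2.2
    have hcard : ∀ Y ∈ S, #Y + 1 = a ∧ Y ∈ G := by
      intro Y hY
      have h1 := card_lt_card ((hmem Y hY).2.2.ssubset_of_ne (hall Y hY))
      exact (hF Y (hmem Y hY).1).resolve_left (by omega)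
    obtain ⟨Y, hY⟩ := card_pos.1 (show 0 < #S by omega)
    have h1 := card_lt_card ((hmem Y hY).2.2.ssubset_of_ne (hall Y hY))
    have h2 := (hcard Y hY).1
    have h3 := hG X (by omega)
    have h4 : S ⊆ {Z ∈ G | Z ⊆ X} := fun Z hZ => mem_filter.2 ⟨(hcard Z hZ).2, (hmem Z hZ).2.2⟩
    have := card_le_card h4
    omega

theorem card_le_of_hasAntichain_top {F : Set (Finset (Fin n))} {G : Finset (Finset (Fin n))}
    {b t : ℕ} (ht : 1 ≤ t) (hF : ∀ Y ∈ F, #Y ≤ b ∨ #Y = b + 1 ∧ Y ∈ G)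
    (hG : ∀ Y : Finset (Fin n), #Y = b → #{X ∈ G | Y ⊆ X} ≤ t - 1) (hG0 : t = 1 → G = ∅)
    {A : Finset (Fin n)} (h : HasAntichain F A univ t) : #A + (if t = 1 then 0 else 1) ≤ b := by
  obtain ⟨S, hS, hanti, hmem⟩ := h
  split_ifs with ht1
  · obtain ⟨Y, hY⟩ := card_pos.1 (show 0 < #S by omega)
    have := card_le_card (hmem Y hY).2.1
    rcases hF Y (hmem Y hY).1 with h | ⟨-, h⟩
    · omega
    · simp [hG0 ht1] at h
  · by_contra! hlt
    have hall : ∀ Y ∈ S, A ≠ Y := by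
      rintro Y hY rfl
      obtain ⟨Z, hZ, hne⟩ := exists_mem_ne (show 1 < #S by omega) A
      exact hanti hY hZ hne.symm (hmem Z hZ).2.1
    have hcard : ∀ Y ∈ S, #Y = b + 1 ∧ Y ∈ G := by
      intro Y hY
      have h1 := card_lt_card ((hmem Y hY).2.1.ssubset_of_ne (hall Y hY))
      exact (hF Y (hmem Y hY).1).resolve_left (by omega)
    obtain ⟨Y, hY⟩ := card_pos.1 (show 0 < #S by omega)
    have h1 := card_lt_card ((hmem Y hY).2.1.ssubset_of_ne (hall Y hY))
    have h2 := (hcard Y hY).1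
    have h3 := hG A (by omega)
    have h4 : S ⊆ {Z ∈ G | A ⊆ Z} := fun Z hZ => mem_filter.2 ⟨(hcard Z hZ).2, (hmem Z hZ).2.1⟩
    have := card_le_card h4
    omega

theorem fPair_eq_add {r t : ℕ} :
    fPair r t = (if r = 1 then 0 else 1) + (if t = 1 then 0 else 1) := by
  unfold fPair
  by_cases h3 : r = 1 <;> by_cases h4 : t = 1 <;> simp [h3, h4]

/-- Consecutive levels, with a sparse family added just below and another one just above. -/
theorem inducedFree_of_levels {F : Set (Finset (Fin n))} {G H : Finset (Finset (Fin n))}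
    {r t a b : ℕ} {ss : List ℕ} (hr : 1 ≤ r) (ht : 1 ≤ t)
    (hF : ∀ Y ∈ F, a ≤ #Y ∧ #Y ≤ b ∨ #Y + 1 = a ∧ #Y ≤ b ∧ Y ∈ G ∨ #Y = b + 1 ∧ a ≤ #Y ∧ Y ∈ H)
    (hG : ∀ Y : Finset (Fin n), #Y = a → #{X ∈ G | X ⊆ Y} ≤ r - 1) (hG0 : r = 1 → G = ∅)
    (hH : ∀ Y : Finset (Fin n), #Y = b → #{X ∈ H | Y ⊆ X} ≤ t - 1) (hH0 : t = 1 → H = ∅)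
    (hab : b < a + ((ss.map mStar).sum + fPair r t)) : InducedFree (KPoset r ss t) F := by
  rw [fPair_eq_add] at hab
  refine inducedFree_of_ends (a := a + if r = 1 then 0 else 1)
    (b := b) (y := if t = 1 then 0 else 1) (fun X hX => ?_) (fun A hA => ?_) ?_
  · refine le_card_of_hasAntichain_bottom hr (fun Y hY => ?_) hG hG0 hX
    rcases hF Y hY with h | h | h
    · exact Or.inl h.1
    · exact Or.inr ⟨h.1, h.2.2⟩
    · exact Or.inl h.2.1
  · refine card_le_of_hasAntichain_top ht (fun Y hY => ?_) hH hH0 hA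
    rcases hF Y hY with h | h | h
    · exact Or.inl h.2
    · exact Or.inl h.2.1
    · exact Or.inr ⟨h.1, h.2.2⟩
  · omega

theorem inducedFree_consecutiveLevels {r t : ℕ} {ss : List ℕ} (hr : 1 ≤ r) (ht : 1 ≤ t)
    (n a : ℕ) :
    InducedFree (KPoset r ss t) (consecutiveLevels n a ((ss.map mStar).sum + fPair r t)) := by
  -- With no levels at all, the subtraction in the upper end `b` below could truncate.
  rcases Nat.eq_zero_or_pos ((ss.map mStar).sum + fPair r t) with h0 | h0
  · rintro ⟨i, hi⟩
    have := nonempty_kPoset (t := t) (ss := ss) hr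
    have h := hi (Classical.arbitrary _)
    rw [h0] at h
    exact absurd h.1 (not_le.2 h.2)
  · refine inducedFree_of_levels (G := ∅) (H := ∅) (a := a)
      (b := a + ((ss.map mStar).sum + fPair r t) - 1) hr ht (fun Y hY => Or.inl ⟨hY.1, ?_⟩)
      (by simp) (fun _ => rfl) (by simp) (fun _ => rfl) (by omega)
    have := hY.2
    omega

/-- The sum of the elements of a set, modulo `n`. -/
def residue (X : Finset (Fin n)) : ZMod n :=
  ∑ x ∈ X, (x.val : ZMod n)

theorem natCast_val_injective : Function.Injective fun x : Fin n => (x.val : ZMod n) := by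
  intro x y hxy
  have := (ZMod.natCast_eq_natCast_iff' _ _ _).1 hxy
  rw [Nat.mod_eq_of_lt x.2, Nat.mod_eq_of_lt y.2] at this
  exact Fin.ext this

/-- Each of the two sets omits one element of `Z`, and that element is determined by the residue
because the elements of `Fin n` are distinct modulo `n`. -/
theorem eq_of_residue_eq {X Y Z : Finset (Fin n)} (hX : X ⊆ Z) (hY : Y ⊆ Z) (hXc : #X + 1 = #Z)
    (hYc : #Y + 1 = #Z) (h : residue X = residue Y) : X = Y := by
  obtain ⟨x, hx, rfl⟩ := Finset.covBy_iff_exists_insert.1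
    (Finset.covBy_iff_card_sdiff_eq_one.2 ⟨hX, by rw [card_sdiff_of_subset hX]; omega⟩)
  obtain ⟨y, hy, hxy⟩ := Finset.covBy_iff_exists_insert.1
    (Finset.covBy_iff_card_sdiff_eq_one.2 ⟨hY, by rw [card_sdiff_of_subset hY]; omega⟩)
  have h1 : residue (insert x X) = residue (insert y Y) := by rw [hxy]
  unfold residue at h h1
  rw [sum_insert hx, sum_insert hy, h] at h1
  obtain rfl := natCast_val_injective (add_right_cancel h1)
  rw [← erase_insert hx, ← erase_insert hy, hxy]

theorem eq_of_residue_eq_of_subset {X Y Z : Finset (Fin n)} (hX : Z ⊆ X) (hY : Z ⊆ Y)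
    (hXc : #Z + 1 = #X) (hYc : #Z + 1 = #Y) (h : residue X = residue Y) : X = Y := by
  obtain ⟨x, hx, rfl⟩ := Finset.covBy_iff_exists_insert.1
    (Finset.covBy_iff_card_sdiff_eq_one.2 ⟨hX, by rw [card_sdiff_of_subset hX]; omega⟩)
  obtain ⟨y, hy, rfl⟩ := Finset.covBy_iff_exists_insert.1
    (Finset.covBy_iff_card_sdiff_eq_one.2 ⟨hY, by rw [card_sdiff_of_subset hY]; omega⟩)
  unfold residue at h
  rw [sum_insert hx, sum_insert hy] at h
  rw [natCast_val_injective (add_right_cancel h)]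

/-- A union of `w` residue classes of a level, of at least average size. -/
theorem exists_sparse_family {w : ℕ} (hn : 0 < n) (hw : w ≤ n) (l : ℕ) :
    ∃ G : Finset (Finset (Fin n)), (∀ X ∈ G, #X = l) ∧ w * n.choose l ≤ n * #G ∧
      (∀ Y : Finset (Fin n), #Y = l + 1 → #{X ∈ G | X ⊆ Y} ≤ w) ∧
      (∀ Y : Finset (Fin n), #Y + 1 = l → #{X ∈ G | Y ⊆ X} ≤ w) ∧ (w = 0 → G = ∅) := by
  have : NeZero n := ⟨hn.ne'⟩
  obtain ⟨R, -, hR⟩ := exists_subset_card_eq (s := (univ : Finset (ZMod n))) (n := w)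
    (by rwa [card_univ, ZMod.card])
  let L : Finset (Finset (Fin n)) := powersetCard l univ
  let G : ZMod n → Finset (Finset (Fin n)) := fun d => {X ∈ L | residue X - d ∈ R}
  have hLcard : #L = n.choose l := by rw [card_powersetCard, card_univ, Fintype.card_fin]
  -- For each `X` exactly `w` translates `d` put `residue X - d` into `R`, so some translate reaches
  -- the average `w / n` of the level.
  have hsum : ∑ d, #(G d) = w * n.choose l := by
    simp only [G, card_filter]
    rw [sum_comm, ← hLcard, mul_comm, ← smul_eq_mul, ← sum_const]
    refine sum_congr rfl fun X _ => ?_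
    rw [← card_filter, ← hR]
    refine card_nbij' (fun d => residue X - d) (fun d => residue X - d) ?_ ?_ ?_ ?_ <;>
      intro d hd <;> simp_all
  obtain ⟨d, -, hd⟩ := exists_le_of_sum_le (s := (univ : Finset (ZMod n)))
    (f := fun _ => w * n.choose l) (g := fun d => n * #(G d)) univ_nonempty (by
      rw [sum_const, card_univ, ZMod.card, smul_eq_mul, ← mul_sum, hsum])
  have hG : ∀ X ∈ G d, #X = l ∧ residue X - d ∈ R := fun X hX => by
    simpa [G, L, mem_powersetCard] using hX
  refine ⟨G d, fun X hX => (hG X hX).1, hd, fun Y hY => ?_, fun Y hY => ?_, fun hw0 => ?_⟩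
  · rw [← hR]
    refine card_le_card_of_injOn (fun X => residue X - d)
      (fun X hX => (hG X (mem_filter.1 hX).1).2) fun X hX Z hZ hXZ => ?_
    obtain ⟨hX1, hX2⟩ := mem_filter.1 hX
    obtain ⟨hZ1, hZ2⟩ := mem_filter.1 hZ
    exact eq_of_residue_eq hX2 hZ2 (by rw [(hG X hX1).1, hY]) (by rw [(hG Z hZ1).1, hY])
      (sub_left_injective hXZ)
  · rw [← hR]
    refine card_le_card_of_injOn (fun X => residue X - d)
      (fun X hX => (hG X (mem_filter.1 hX).1).2) fun X hX Z hZ hXZ => ?_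
    obtain ⟨hX1, hX2⟩ := mem_filter.1 hX
    obtain ⟨hZ1, hZ2⟩ := mem_filter.1 hZ
    exact eq_of_residue_eq_of_subset hX2 hZ2 (by rw [(hG X hX1).1, hY]) (by rw [(hG Z hZ1).1, hY])
      (sub_left_injective hXZ)
  · rw [hw0, card_eq_zero] at hR
    rw [eq_empty_iff_forall_notMem]
    intro X hX
    have := (hG X hX).2
    simp [hR] at this

/-- The `k` middle levels. -/
def middleLevels (n k : ℕ) : Finset (Finset (Fin n)) :=
  {X | (n - k) / 2 + 1 ≤ #X ∧ #X ≤ (n - k) / 2 + k}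

theorem card_middleLevels (n k : ℕ) : #(middleLevels n k) = middleSum n k := by
  unfold middleSum
  rw [card_eq_sum_card_fiberwise (f := fun X => #X - (n - k) / 2) (t := Icc 1 k)]
  · refine sum_congr rfl fun i hi => ?_
    have hi' := mem_Icc.1 hi
    have := card_powersetCard ((n - k) / 2 + i) (univ : Finset (Fin n))
    rw [card_univ, Fintype.card_fin] at this
    rw [← this]
    congr 1
    ext X
    simp only [middleLevels, mem_filter, mem_univ, true_and, mem_powersetCard, subset_univ]
    omega
  · intro X hX
    have hX' := (mem_filter.1 hX).2
    rw [mem_coe, mem_Icc]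
    dsimp only
    omega

theorem card_le_laStar {P : Type} [PartialOrder P] {F : Finset (Finset (Fin n))} [Nonempty P]
    (hF : InducedFree P (F : Set (Finset (Fin n)))) : #F ≤ LaStar P n :=
  (laStar_isGreatest P n).2 ⟨F, hF, rfl⟩

theorem middleSum_add_le_laStar {r t : ℕ} {ss : List ℕ} (hr : 1 ≤ r) (ht : 1 ≤ t)
    {k : ℕ} (hk : k = (ss.map mStar).sum + fPair r t) (hn : r + t ≤ n) :
    ∃ g h : ℕ, (r - 1) * n.choose ((n - k) / 2) ≤ n * g ∧
      (t - 1) * n.choose ((n - k) / 2 + k + 1) ≤ n * h ∧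
      middleSum n k + g + h ≤ LaStar (KPoset r ss t) n := by
  obtain ⟨G, hGc, hG, hGlo, -, hG0⟩ := exists_sparse_family (w := r - 1) (n := n) (by omega) (by omega)
    ((n - k) / 2)
  obtain ⟨H, hHc, hH, -, hHhi, hH0⟩ := exists_sparse_family (w := t - 1) (n := n) (by omega) (by omega)
    ((n - k) / 2 + k + 1)
  have := nonempty_kPoset (t := t) (ss := ss) hr
  refine ⟨#G, #H, hG, hH, ?_⟩
  have hd1 : Disjoint (middleLevels n k) G := Finset.disjoint_left.2 fun X h1 h2 => by
    have := (mem_filter.1 h1).2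
    have := hGc X h2
    omega
  have hd2 : Disjoint (middleLevels n k ∪ G) H := Finset.disjoint_left.2 fun X h1 h2 => by
    have h3 := hHc X h2
    rcases mem_union.1 h1 with h1 | h1
    · have := (mem_filter.1 h1).2
      omega
    · have := hGc X h1
      omega
  rw [← card_middleLevels, ← card_union_of_disjoint hd1, ← card_union_of_disjoint hd2]
  refine card_le_laStar (inducedFree_of_levels (G := G) (H := H) (a := (n - k) / 2 + 1)
    (b := (n - k) / 2 + k) hr ht (fun X hX => ?_) ?_ ?_ ?_ ?_ (by omega))
  · rw [mem_coe, mem_union, mem_union] at hX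
    rcases hX with (hX | hX) | hX
    · exact Or.inl (mem_filter.1 hX).2
    · have := hGc X hX
      exact Or.inr (Or.inl ⟨by omega, by omega, hX⟩)
    · have := hHc X hX
      exact Or.inr (Or.inr ⟨by omega, by omega, hX⟩)
  · exact fun Y hY => hGlo Y hY
  · exact fun h => hG0 (by omega)
  · exact fun Y hY => hHhi Y (by omega)
  · exact fun h => hH0 (by omega)

theorem mul_le_middleSum {k : ℕ} (hn : 2 * k + 5 ≤ n) :
    k * ((1 - 2 * (k + 2 : ℕ) * ((k + 2 : ℕ) + 1) / n : ℝ) * (n.choose (n / 2) : ℝ)) ≤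
      middleSum n k := by
  unfold middleSum
  push_cast
  refine le_trans (le_of_eq ?_) (card_nsmul_le_sum _ _ _ fun i hi =>
    one_sub_mul_le_choose (j := k + 2) ?_ ?_ ?_)
  · rw [Nat.card_Icc, nsmul_eq_mul]
    push_cast
    simp
  all_goals have := mem_Icc.1 hi; omega

end Lower

/-! ### Assembling the asymptotic statements. -/

theorem eventually_middleSum_add_le_laStar {r t : ℕ} {ss : List ℕ} (hr : 1 ≤ r) (ht : 1 ≤ t) :
    ∃ C : ℝ, ∀ᶠ n : ℕ in atTop,
      (middleSum n ((ss.map mStar).sum + fPair r t) : ℝ)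
          + (((r : ℝ) + t - 2) / n - C / (n : ℝ) ^ 2) * (n.choose ((n + 1) / 2) : ℝ)
        ≤ (LaStar (KPoset r ss t) n : ℝ) := by
  obtain ⟨k, hk⟩ : ∃ k, k = (ss.map mStar).sum + fPair r t := ⟨_, rfl⟩
  -- The two added levels lie within `k + 2` of the middle, so each binomial coefficient loses a
  -- fraction at most `2 * (k + 2) * (k + 3) / n`.
  refine ⟨((r : ℝ) + t - 2) * (2 * (k + 2 : ℕ) * ((k + 2 : ℕ) + 1)), ?_⟩
  filter_upwards [eventually_ge_atTop (r + t), eventually_ge_atTop (2 * k + 5)] with n hn hnk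
  obtain ⟨g, h, hg, hh, hle⟩ := middleSum_add_le_laStar (ss := ss) hr ht hk hn
  rw [← hk, choose_add_one_div_two]
  have e1 := one_sub_mul_le_choose (n := n) (i := (n - k) / 2) (j := k + 2) (by omega) (by omega)
    (by omega)
  have e2 := one_sub_mul_le_choose (n := n) (i := (n - k) / 2 + k + 1) (j := k + 2) (by omega)
    (by omega) (by omega)
  set D : ℝ := 2 * (k + 2 : ℕ) * ((k + 2 : ℕ) + 1)
  have hr' : ((r - 1 : ℕ) : ℝ) = r - 1 := by rw [Nat.cast_sub hr, Nat.cast_one]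
  have ht' : ((t - 1 : ℕ) : ℝ) = t - 1 := by rw [Nat.cast_sub ht, Nat.cast_one]
  have hn0 : (0 : ℝ) < n := by exact_mod_cast (by omega : 0 < n)
  have hg' : ((r - 1 : ℕ) : ℝ) * n.choose ((n - k) / 2) ≤ n * g := by exact_mod_cast hg
  have hh' : ((t - 1 : ℕ) : ℝ) * n.choose ((n - k) / 2 + k + 1) ≤ n * h := by exact_mod_cast hh
  have f1 := (mul_le_mul_of_nonneg_left e1 (Nat.cast_nonneg (r - 1))).trans hg'
  have f2 := (mul_le_mul_of_nonneg_left e2 (Nat.cast_nonneg (t - 1))).trans hh'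
  rw [hr'] at f1
  rw [ht'] at f2
  have hle' : (middleSum n k : ℝ) + g + h ≤ LaStar (KPoset r ss t) n := by exact_mod_cast hle
  have key : (((r : ℝ) + t - 2) / n - ((r : ℝ) + t - 2) * D / (n : ℝ) ^ 2) * n.choose (n / 2) ≤
      g + h := by
    have : (((r : ℝ) + t - 2) / n - ((r : ℝ) + t - 2) * D / (n : ℝ) ^ 2) * n.choose (n / 2) =
        ((r - 1) * ((1 - D / n) * n.choose (n / 2)) +
          (t - 1) * ((1 - D / n) * n.choose (n / 2))) / n := by
      field_simp
      ring
    rw [this, div_le_iff₀ hn0]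
    linarith
  linarith

/-- If every `k` consecutive levels are induced `P`-free, then the middle ones give a lower
bound. -/
theorem eventually_mul_choose_le_laStar {P : Type} [PartialOrder P] [Nonempty P] {k : ℕ}
    (h : ∀ n a : ℕ, InducedFree P (consecutiveLevels n a k)) :
    ∃ C : ℝ, 0 ≤ C ∧ ∀ᶠ n : ℕ in atTop,
      (k - C / n) * (n.choose (n / 2) : ℝ) ≤ (LaStar P n : ℝ) := by
  refine ⟨k * (2 * (k + 2 : ℕ) * ((k + 2 : ℕ) + 1)), by positivity, ?_⟩
  filter_upwards [eventually_ge_atTop (2 * k + 5)] with n hn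
  have h1 : (middleLevels n k).card ≤ LaStar P n := by
    refine card_le_laStar fun ⟨i, hi⟩ => h n ((n - k) / 2 + 1) ⟨i, fun p => ?_⟩
    have := (Finset.mem_filter.1 (Finset.mem_coe.1 (hi p))).2
    exact ⟨this.1, by omega⟩
  rw [card_middleLevels] at h1
  refine le_trans (le_of_eq ?_) ((mul_le_middleSum hn).trans (Nat.cast_le.2 h1))
  ring

theorem finite_completeMultilevel (ℓ : List ℕ) : Finite (CompleteMultilevel ℓ) := by
  refine Finite.of_injective
    (fun x : CompleteMultilevel ℓ => (⟨x.level, x.pos⟩ : Σ i, Fin (ℓ.get i))) ?_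
  rintro ⟨i, p⟩ ⟨j, q⟩ h
  cases h
  rfl

theorem le_eStar {r t : ℕ} {ss : List ℕ} (hr : 1 ≤ r) (ht : 1 ≤ t) :
    (ss.map mStar).sum + fPair r t ≤ eStar (KPoset r ss t) := by
  have := nonempty_kPoset (t := t) (ss := ss) hr
  have := finite_completeMultilevel (r :: (ss ++ [t]))
  exact (eStar_isGreatest (KPoset r ss t)).2 fun n a => inducedFree_consecutiveLevels hr ht n a

theorem choose_middle_pos (n : ℕ) : (0 : ℝ) < n.choose (n / 2) := by
  exact_mod_cast Nat.choose_pos (Nat.div_le_self _ _)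

theorem hasPiStar_of_bounds {P : Type} [PartialOrder P] {x y C : ℝ} {ε : ℕ → ℝ}
    (hlo : ∀ᶠ n : ℕ in atTop, (x - C / n) * (n.choose (n / 2) : ℝ) ≤ (LaStar P n : ℝ))
    (hε : Tendsto ε atTop (𝓝 0))
    (hhi : ∀ᶠ n : ℕ in atTop, (LaStar P n : ℝ) ≤ (x + y / n + ε n / n) * (n.choose (n / 2) : ℝ)) :
    HasPiStar P x := by
  have l1 : Tendsto (fun n : ℕ => x - C / n) atTop (𝓝 x) := by
    simpa using tendsto_const_nhds.sub (tendsto_const_div_atTop_nhds_zero_nat C)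
  have l2 : Tendsto (fun n : ℕ => x + y / n + ε n / n) atTop (𝓝 x) := by
    simpa using (tendsto_const_nhds.add (tendsto_const_div_atTop_nhds_zero_nat y)).add
      (hε.div_atTop tendsto_natCast_atTop_atTop)
  refine tendsto_of_tendsto_of_tendsto_of_le_of_le' l1 l2 ?_ ?_
  · filter_upwards [hlo] with n hn
    rwa [le_div_iff₀ (choose_middle_pos n)]
  · filter_upwards [hhi] with n hn
    rwa [div_le_iff₀ (choose_middle_pos n)]

theorem exists_laStar_le {r t : ℕ} {ss : List ℕ} {M : ℕ → ℝ} (hr : 1 ≤ r) (ht : 1 ≤ t)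
    (hss : ss ≠ []) (h2 : ∀ s ∈ ss, 2 ≤ s) (hM0 : ∀ s, 0 ≤ M s)
    (hM : ∀ s ∈ ss, ∀ N, capSum (s - 1) N ≤ M s) :
    ∃ ε : ℕ → ℝ, Tendsto ε atTop (𝓝 0) ∧ ∀ᶠ n : ℕ in atTop, (LaStar (KPoset r ss t) n : ℝ) ≤
      ((ss.map M).sum + fPair r t + 2 * ((r : ℝ) + t - 2) / n + ε n / n) *
        (n.choose (n / 2) : ℝ) :=
  exists_tendsto_zero_of_forall_pos choose_middle_pos
    fun _ hη => eventually_laStar_le hr ht hss h2 hM0 hM hη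

theorem bounds_and_hasPiStar {r s t : ℕ} (hr : 1 ≤ r) (ht : 1 ≤ t) (hs : 2 ≤ s)
    (h : ∀ N, capSum (s - 1) N ≤ mStar s) :
    (∃ C : ℝ, ∀ᶠ n : ℕ in atTop,
      (middleSum n (mStar s + fPair r t) : ℝ)
          + (((r : ℝ) + t - 2) / n - C / (n : ℝ) ^ 2) * (n.choose ((n + 1) / 2) : ℝ)
        ≤ (LaStar (KPoset r [s] t) n : ℝ)) ∧
    (∃ ε : ℕ → ℝ, Tendsto ε atTop (𝓝 0) ∧ ∀ᶠ n : ℕ in atTop,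
      (LaStar (KPoset r [s] t) n : ℝ)
        ≤ (mStar s + fPair r t + 2 * ((r : ℝ) + t - 2) / n + ε n / n)
          * (n.choose (n / 2) : ℝ)) ∧
    HasPiStar (KPoset r [s] t) (mStar s + fPair r t) := by
  have hlo := eventually_middleSum_add_le_laStar (ss := [s]) hr ht
  have hhi := exists_laStar_le (ss := [s]) (M := fun s => mStar s) hr ht (by simp) (by simpa using hs)
    (fun s => Nat.cast_nonneg _) (by simpa using h)
  simp only [List.map_cons, List.map_nil, List.sum_cons, List.sum_nil, add_zero] at hlo hhi
  refine ⟨hlo, hhi, ?_⟩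
  obtain ⟨ε, hε, hhi⟩ := hhi
  have := nonempty_kPoset (t := t) (ss := [s]) hr
  obtain ⟨C, -, hC⟩ := eventually_mul_choose_le_laStar fun n a =>
    inducedFree_consecutiveLevels (ss := [s]) hr ht n a
  refine hasPiStar_of_bounds (C := C) ?_ hε hhi
  simpa using hC

/-- The value of `eStar` need not be computed: its definition gives the lower bound, and the leading
coefficient of the upper bound is at most `eStar` by `le_eStar`. -/
theorem exists_abs_laStar_sub_le {r t : ℕ} {ss : List ℕ} (hr : 1 ≤ r) (ht : 1 ≤ t)
    (hss : ss ≠ []) (h2 : ∀ s ∈ ss, 2 ≤ s) (hM : ∀ s ∈ ss, ∀ N, capSum (s - 1) N ≤ mStar s) :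
    ∃ C : ℝ, ∀ᶠ n : ℕ in atTop,
      |(LaStar (KPoset r ss t) n : ℝ)
          - (eStar (KPoset r ss t) : ℝ) * (n.choose (n / 2) : ℝ)|
        ≤ C / n * (n.choose (n / 2) : ℝ) := by
  have := nonempty_kPoset (t := t) (ss := ss) hr
  have := finite_completeMultilevel (r :: (ss ++ [t]))
  obtain ⟨C, hC0, hC⟩ := eventually_mul_choose_le_laStar (eStar_isGreatest (KPoset r ss t)).1
  have hhi := eventually_laStar_le (M := fun s => mStar s) hr ht hss h2
    (fun s => Nat.cast_nonneg _) hM one_pos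
  refine ⟨C + 2 * ((r : ℝ) + t) + 1, ?_⟩
  filter_upwards [hC, hhi, eventually_gt_atTop 0] with n h1 h3 hn
  have hn0 : (0 : ℝ) < n := by exact_mod_cast hn
  have hc := choose_middle_pos n
  set B : ℝ := (n.choose (n / 2) : ℝ)
  have he : ((ss.map fun s => (mStar s : ℝ)).sum + fPair r t) ≤ (eStar (KPoset r ss t) : ℝ) := by
    have := le_eStar (ss := ss) hr ht
    have h4 : (((ss.map mStar).sum + fPair r t : ℕ) : ℝ) ≤ eStar (KPoset r ss t) := by
      exact_mod_cast this
    rw [Nat.cast_add, Nat.cast_list_sum, List.map_map] at h4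
    exact h4
  have g1 : C / n * B ≤ (C + 2 * ((r : ℝ) + t) + 1) / n * B := by
    gcongr
    have : (0 : ℝ) ≤ (r : ℝ) + t := by positivity
    linarith
  have g2 : (2 * ((r : ℝ) + t - 2) / n + 1 / n) * B ≤ (C + 2 * ((r : ℝ) + t) + 1) / n * B := by
    rw [← add_div]
    gcongr
    linarith
  have g3 := mul_le_mul_of_nonneg_right he hc.le
  rw [abs_le]
  constructor <;> linarith

theorem theorem1p12 :
    -- (i)
    (∀ r t : ℕ, 1 ≤ r → 1 ≤ t →
      (∃ C : ℝ, ∀ᶠ n : ℕ in atTop,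
        (middleSum n (4 + fPair r t) : ℝ)
            + (((r : ℝ) + t - 2) / n - C / (n : ℝ) ^ 2) * (n.choose ((n + 1) / 2) : ℝ)
          ≤ (LaStar (KPoset r [4] t) n : ℝ)) ∧
      (∃ ε : ℕ → ℝ, Tendsto ε atTop (𝓝 0) ∧ ∀ᶠ n : ℕ in atTop,
        (LaStar (KPoset r [4] t) n : ℝ)
          ≤ (4 + fPair r t + 2 * ((r : ℝ) + t - 2) / n + ε n / n) * (n.choose (n / 2) : ℝ)) ∧
      HasPiStar (KPoset r [4] t) (4 + fPair r t)) ∧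
    -- (ii)
    (∀ c : ℝ, 1 / 2 < c → c < 1 → ∃ sc : ℕ, ∀ r s t : ℕ, 1 ≤ r → 1 ≤ t → sc ≤ s →
      (s : ℝ) ≤ c * ((mStar s).choose ((mStar s + 1) / 2) : ℝ) →
      (∃ C : ℝ, ∀ᶠ n : ℕ in atTop,
        (middleSum n (mStar s + fPair r t) : ℝ)
            + (((r : ℝ) + t - 2) / n - C / (n : ℝ) ^ 2) * (n.choose ((n + 1) / 2) : ℝ)
          ≤ (LaStar (KPoset r [s] t) n : ℝ)) ∧
      (∃ ε : ℕ → ℝ, Tendsto ε atTop (𝓝 0) ∧ ∀ᶠ n : ℕ in atTop,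
        (LaStar (KPoset r [s] t) n : ℝ)
          ≤ (mStar s + fPair r t + 2 * ((r : ℝ) + t - 2) / n + ε n / n)
            * (n.choose (n / 2) : ℝ)) ∧
      HasPiStar (KPoset r [s] t) (mStar s + fPair r t)) ∧
    -- (iii)
    (∃ s₀ : ℕ, ∀ r s t : ℕ, 1 ≤ r → 1 ≤ t → s₀ ≤ s →
      (∃ C : ℝ, ∀ᶠ n : ℕ in atTop,
        (middleSum n (mStar s + fPair r t) : ℝ)
            + (((r : ℝ) + t - 2) / n - C / (n : ℝ) ^ 2) * (n.choose ((n + 1) / 2) : ℝ)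
          ≤ (LaStar (KPoset r [s] t) n : ℝ)) ∧
      (∃ ε : ℕ → ℝ, Tendsto ε atTop (𝓝 0) ∧ ∀ᶠ n : ℕ in atTop,
        (LaStar (KPoset r [s] t) n : ℝ)
          ≤ (mStar s + 1 + fPair r t + 2 * ((r : ℝ) + t - 2) / n + ε n / n)
            * (n.choose (n / 2) : ℝ))) ∧
    -- (iv)
    (∀ c : ℝ, 1 / 2 < c → c < 1 → ∃ sc : ℕ, ∀ (r : ℕ) (ss : List ℕ) (t : ℕ),
      1 ≤ r → 1 ≤ t → ss ≠ [] →
      (∀ s ∈ ss, s = 4 ∨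
        (sc ≤ s ∧ (s : ℝ) ≤ c * ((mStar s).choose ((mStar s + 1) / 2) : ℝ))) →
      ∃ C : ℝ, ∀ᶠ n : ℕ in atTop,
        |(LaStar (KPoset r ss t) n : ℝ)
            - (eStar (KPoset r ss t) : ℝ) * (n.choose (n / 2) : ℝ)|
          ≤ C / n * (n.choose (n / 2) : ℝ)) := by
  have hfour : ∀ N, capSum (4 - 1) N ≤ mStar 4 := by
    rw [mStar_four]
    exact_mod_cast capSum_three_le
  refine ⟨fun r t hr ht => ?_, fun c hc0 hc => ?_, ?_, fun c hc0 hc => ?_⟩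
  · have h := bounds_and_hasPiStar hr ht (by norm_num) hfour
    rw [mStar_four] at h
    exact_mod_cast h
  · obtain ⟨sc, hsc⟩ := exists_capSum_le_mStar (by linarith : 0 < c) hc
    exact ⟨sc, fun r s t hr ht hs hsC =>
      bounds_and_hasPiStar hr ht (hsc s hs).1 ((hsc s hs).2 hsC)⟩
  · obtain ⟨s₀, hs₀⟩ := exists_capSum_le_mStar_add_one
    refine ⟨s₀, fun r s t hr ht hs => ⟨?_, ?_⟩⟩
    · simpa using eventually_middleSum_add_le_laStar (ss := [s]) hr ht
    · simpa using exists_laStar_le (ss := [s]) (M := fun s => (mStar s : ℝ) + 1) hr ht (by simp)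
        (by simpa using (hs₀ s hs).1) (fun s => by positivity) (by simpa using (hs₀ s hs).2)
  · obtain ⟨sc, hsc⟩ := exists_capSum_le_mStar (by linarith : 0 < c) hc
    refine ⟨sc, fun r ss t hr ht hss h => exists_abs_laStar_sub_le hr ht hss (fun s hs => ?_)
      fun s hs => ?_⟩
    · rcases h s hs with rfl | h
      · norm_num
      · exact (hsc s h.1).1
    · rcases h s hs with rfl | h
      · exact hfour
      · exact (hsc s h.1).2 h.2
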